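/- Let $l_p(\mathbb Z)$ be the space of real sequences with its usual norm $\|\cdot\|_p$, let $\|T\|_p$ denote the operator norm of a bounded linear operator $T$ on $l_p(\mathbb Z)$, and call the elements of $l_1(\mathbb Z)$ masks. For a mask $\alpha$ let $\alpha(z)=\sum_{m\in\mathbb Z}\alpha_m z^m$ ($|z|=1$) be its symbol and $\alpha_{ev}=(\alpha_{2m})_{m\in\mathbb Z}$ its even part. For masks $\alpha,\gamma$ let $S_\alpha$ be the subdivision operator, $(S_\alpha c)_m=\sum_{i}\alpha_{m-2i}c_i$, let $D_\gamma$ be the decimation operator, $(D_\gamma c)_m=\sum_i\gamma_{m-i}c_{2i}$, and let $A_\gamma$ be the operator of the bi-infinite Toeplitz matrix $(\gamma_{m-i})_{m,i\in\mathbb Z}$. Let $k\ge 2$ and $0\le\nu\le k-2$ be integers, and let $\alpha=\alpha^{2k,\nu}$ be the primal pseudo-spline mask, that is, the finitely supported mask with symbol $$\alpha^{2k,\nu}(z)=\frac{z^{-k}(1+z)^{2k}}{2^{2k-1}}\sum_{i=0}^{\nu}\binom{k+i-1}{i}\left(\frac12-\frac{z+z^{-1}}4\right)^{i}.$$ Put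 $$\kappa=\frac{2^{k+\nu-1}}{\sum_{i=0}^{\nu}\binom{k+\nu}{i}},\qquad s=\left\lfloor\frac{k+\nu}2\right\rfloor,\qquad \lambda=\left(\frac{\sqrt\kappa-1}{\sqrt\kappa+1}\right)^{1/s},\qquad C(k,\nu)=\kappa\cdot\max\left\{1,\frac{(1+\sqrt\kappa)^2}{2\kappa}\right\}\cdot\frac{1+\lambda}{1-\lambda}.$$ Then there is exactly one mask $\gamma\in l_1(\mathbb Z)$ with $\gamma(z)=1/\alpha_{ev}(z)$ for all $|z|=1$. Let $j\ge 0$ and $c^{(j)},\tilde c^{(j)}\in l_p(\mathbb Z)$, let $\{c^{(0)};d^{(1)},\dots,d^{(j)}\}$ be the pyramid obtained from $c^{(j)}$ by $$c^{(\ell-1)}=D_\gamma c^{(\ell)},\qquad d^{(\ell)}=c^{(\ell)}-S_\alpha c^{(\ell-1)},\qquad \ell=j,\dots,1,$$ and let $\{\tilde c^{(0)};\tilde d^{(1)},\dots,\tilde d^{(j)}\}$ be the pyramid obtained from $\tilde c^{(j)}$ in the same way. (1) If $p=\infty$, then for $\ell=1,\dots,j$ $$\|c^{(0)}-\tilde c^{(0)}\|_\infty\le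 C(k,\nu)^j\,\|c^{(j)}-\tilde c^{(j)}\|_\infty,$$ $$\|d^{(\ell)}-\tilde d^{(\ell)}\|_\infty\le\Big(\|\mathrm{Id}-S_\alpha D_\gamma\|_\infty\,C(k,\nu)^{j}\,\|c^{(j)}-\tilde c^{(j)}\|_\infty\Big)\,C(k,\nu)^{-\ell},$$ and the first of these bounds also holds when $j=0$. (2) If $p=2$, then for $\ell=1,\dots,j$ $$\|c^{(0)}-\tilde c^{(0)}\|_2\le\|D_\gamma\|_2^{\,j}\,\|c^{(j)}-\tilde c^{(j)}\|_2,$$ $$\|d^{(\ell)}-\tilde d^{(\ell)}\|_2\le\Big(\|\mathrm{Id}-S_\alpha D_\gamma\|_2\,\|D_\gamma\|_2^{\,j}\,\|c^{(j)}-\tilde c^{(j)}\|_2\Big)\,\|D_\gamma\|_2^{-\ell},$$ and the first of these bounds also holds when $j=0$; moreover $$\|D_\gamma\|_2=\|A_\gamma\|_2=\frac{2^{k+\nu-1}}{\sum_{i=0}^{\nu}\binom{k+\nu}{i}}.$$ -/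

import Mathlib

open scoped ENNReal LaurentPolynomial

noncomputable section

namespace MTER

/-- The real sequence space `l_p(ℤ)` with its usual norm. -/
abbrev Seq (p : ℝ≥0∞) := lp (fun _ : ℤ => ℝ) p

/-- A mask is a sequence in `l_1(ℤ)`. -/
abbrev Mask := Seq 1

/-! ### Downsampling, upsampling, convolution -/

/-- Composition with an injective map does not increase the `l_p` norm. -/
theorem exists_comp {p : ℝ≥0∞} [hp : Fact (1 ≤ p)] (e : ℤ → ℤ) (he : e.Injective) (c : Seq p) :
    ∃ f : Seq p, (∀ k, f k = c (e k)) ∧ ‖f‖ ≤ ‖c‖ := by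
  rcases eq_or_ne p ∞ with rfl | htop
  · have hm : Memℓp (E := fun _ : ℤ => ℝ) (fun k => c (e k)) ∞ := by
      refine memℓp_infty ⟨‖c‖, ?_⟩
      rintro _ ⟨k, rfl⟩
      exact lp.norm_apply_le_norm (by simp) c (e k)
    refine ⟨⟨_, hm⟩, fun _ => rfl, ?_⟩
    exact lp.norm_le_of_forall_le (norm_nonneg _)
      fun k => lp.norm_apply_le_norm (by simp) c (e k)
  · have hpos : 0 < p.toReal := ENNReal.toReal_pos (by have := hp.out; positivity) htop
    have hs := (lp.memℓp c).summable hpos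
    have hm : Memℓp (E := fun _ : ℤ => ℝ) (fun k => c (e k)) p :=
      memℓp_gen (hs.comp_injective he)
    refine ⟨⟨_, hm⟩, fun _ => rfl, ?_⟩
    refine lp.norm_le_of_tsum_le hpos (norm_nonneg _) ?_
    rw [lp.norm_rpow_eq_tsum hpos]
    exact (hs.comp_injective he).tsum_le_tsum_of_inj e he
      (fun _ _ => by positivity) (fun _ => le_rfl) hs

theorem exists_upsample {p : ℝ≥0∞} [hp : Fact (1 ≤ p)] (c : Seq p) :
    ∃ f : Seq p, (∀ k, f k = if Even k then c (k / 2) else 0) ∧ ‖f‖ ≤ ‖c‖ := by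
  have hle : ∀ k : ℤ, p ≠ 0 → ‖(if Even k then c (k / 2) else 0 : ℝ)‖ ≤ ‖c‖ := by
    intro k h0
    split_ifs
    · exact lp.norm_apply_le_norm h0 c _
    · simp
  rcases eq_or_ne p ∞ with rfl | htop
  · have hm : Memℓp (E := fun _ : ℤ => ℝ) (fun k => if Even k then c (k / 2) else 0) ∞ := by
      refine memℓp_infty ⟨‖c‖, ?_⟩
      rintro _ ⟨k, rfl⟩
      exact hle k (by simp)
    exact ⟨⟨_, hm⟩, fun _ => rfl, lp.norm_le_of_forall_le (norm_nonneg _)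
      fun k => hle k (by simp)⟩
  · have hpos : 0 < p.toReal := ENNReal.toReal_pos (by have := hp.out; positivity) htop
    have hi : Function.Injective fun k : ℤ => 2 * k := fun a b h => by simpa using h
    have hs : HasSum (fun k : ℤ => ‖(if Even k then c (k / 2) else 0 : ℝ)‖ ^ p.toReal)
        (‖c‖ ^ p.toReal) := by
      refine (hi.hasSum_iff ?_).1 ?_
      · intro k hk
        have : ¬ Even k := fun ⟨m, hm⟩ => hk ⟨m, by simp only; omega⟩
        simp [this, Real.zero_rpow hpos.ne']
      · simpa [Function.comp_def] using lp.hasSum_norm hpos c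
    have hm : Memℓp (E := fun _ : ℤ => ℝ) (fun k => if Even k then c (k / 2) else 0) p :=
      memℓp_gen hs.summable
    exact ⟨⟨_, hm⟩, fun _ => rfl, lp.norm_le_of_tsum_le hpos (norm_nonneg _) hs.tsum_eq.le⟩

theorem exists_conv {p : ℝ≥0∞} [Fact (1 ≤ p)] (a : Mask) (c : Seq p) :
    ∃ f : Seq p, (∀ k, HasSum (fun l => a l * c (k - l)) (f k)) ∧ ‖f‖ ≤ ‖a‖ * ‖c‖ := by
  choose s hs hsn using fun l : ℤ =>
    exists_comp (fun k : ℤ => k - l) (fun x y h => by simpa using h) c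
  have h1 : HasSum (fun l => ‖a l‖) ‖a‖ := by
    simpa using lp.hasSum_norm (p := 1) (by simp) a
  have hle : ∀ l, ‖a l • s l‖ ≤ ‖a l‖ * ‖c‖ := fun l => by
    rw [norm_smul]; exact mul_le_mul_of_nonneg_left (hsn l) (norm_nonneg _)
  have h2 : Summable fun l => a l • s l :=
    Summable.of_norm_bounded (h1.summable.mul_right _) hle
  refine ⟨∑' l, a l • s l, fun k => ?_, ?_⟩
  · have := h2.hasSum.mapL (lp.evalCLM ℝ (fun _ : ℤ => ℝ) p k)
    have h3 : (fun l => lp.evalCLM ℝ (fun _ : ℤ => ℝ) p k (a l • s l))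
        = fun l => a l * c (k - l) := by
      funext l
      change a l * s l k = _
      rw [hs]
    rw [h3] at this
    exact this
  · exact tsum_of_norm_bounded (h1.mul_right _) hle

/-- Downsampling `(c ↓ 2)_k = c_{2k}` on `l_p(ℤ)`; this is also the even part `c_ev`. -/
def downsample {p : ℝ≥0∞} [Fact (1 ≤ p)] : Seq p →L[ℝ] Seq p :=
  LinearMap.mkContinuous
    { toFun := fun c => ⟨fun k => c (2 * k), by
        obtain ⟨f, hf, -⟩ := exists_comp (fun k : ℤ => 2 * k) (fun a b h => by simpa using h) c
        rw [← funext hf]; exact lp.memℓp f⟩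
      map_add' := fun _ _ => rfl
      map_smul' := fun _ _ => rfl } 1 (fun c => by
        obtain ⟨f, hf, hn⟩ := exists_comp (fun k : ℤ => 2 * k) (fun a b h => by simpa using h) c
        rw [one_mul]; convert! hn using 2; exact lp.ext (funext fun k => (hf k).symm))

/-- Upsampling `(c ↑ 2)_k = c_{k/2}` for even `k`, and `0` for odd `k`, on `l_p(ℤ)`. -/
def upsample {p : ℝ≥0∞} [Fact (1 ≤ p)] : Seq p →L[ℝ] Seq p :=
  LinearMap.mkContinuous
    { toFun := fun c => ⟨fun k => if Even k then c (k / 2) else 0, by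
        obtain ⟨f, hf, -⟩ := exists_upsample c
        rw [← funext hf]; exact lp.memℓp f⟩
      map_add' := fun a b => by
        apply lp.ext; funext k
        change (if Even k then a (k / 2) + b (k / 2) else 0)
          = (if Even k then a (k / 2) else 0) + (if Even k then b (k / 2) else 0)
        by_cases h : Even k <;> simp [h]
      map_smul' := fun r a => by
        apply lp.ext; funext k
        by_cases h : Even k <;> simp [h] } 1 (fun c => by
        obtain ⟨f, hf, hn⟩ := exists_upsample c
        rw [one_mul]; convert! hn using 2; exact lp.ext (funext fun k => (hf k).symm))

/-- Convolution `(a * c)_k = ∑_l a_l c_{k-l}` with a mask `a`, as an operator on `l_p(ℤ)`. -/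
def conv {p : ℝ≥0∞} [Fact (1 ≤ p)] (a : Mask) : Seq p →L[ℝ] Seq p :=
  LinearMap.mkContinuous
    { toFun := fun c => ⟨fun k => ∑' l, a l * c (k - l), by
        obtain ⟨f, hf, -⟩ := exists_conv a c
        rw [funext fun k => (hf k).tsum_eq]; exact lp.memℓp f⟩
      map_add' := fun c d => by
        obtain ⟨f, hf, -⟩ := exists_conv a c
        obtain ⟨g, hg, -⟩ := exists_conv a d
        apply lp.ext; funext k
        refine Eq.trans ?_ ((hf k).summable.tsum_add (hg k).summable)
        simp [mul_add]
      map_smul' := fun r c => by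
        apply lp.ext; funext k
        simp [mul_left_comm _ r, tsum_mul_left] } ‖a‖ (fun c => by
        obtain ⟨f, hf, hn⟩ := exists_conv a c
        convert! hn using 2
        exact lp.ext (funext fun k => (hf k).tsum_eq))

theorem downsample_apply {p : ℝ≥0∞} [Fact (1 ≤ p)] (c : Seq p) (k : ℤ) :
    downsample c k = c (2 * k) := rfl

theorem upsample_apply {p : ℝ≥0∞} [Fact (1 ≤ p)] (c : Seq p) (k : ℤ) :
    upsample c k = if Even k then c (k / 2) else 0 := rfl

theorem conv_apply {p : ℝ≥0∞} [Fact (1 ≤ p)] (a : Mask) (c : Seq p) (k : ℤ) :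
    conv a c k = ∑' l, a l * c (k - l) := rfl

/-- The operator of the bi-infinite Toeplitz matrix `A_a = (a_{j-k})_{j,k}`,
which is convolution with `a` (see `toeplitz_apply`). -/
def toeplitz {p : ℝ≥0∞} [Fact (1 ≤ p)] (a : Mask) : Seq p →L[ℝ] Seq p := conv a

theorem toeplitz_apply {p : ℝ≥0∞} [Fact (1 ≤ p)] (a : Mask) (c : Seq p) (j : ℤ) :
    toeplitz a c j = ∑' k, a (j - k) * c k := by
  rw [toeplitz, conv_apply, ← (Equiv.subLeft j).tsum_eq]
  simp

/-- The subdivision operator `S_a c = a * (c ↑ 2)`. -/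
def subdivision {p : ℝ≥0∞} [Fact (1 ≤ p)] (a : Mask) : Seq p →L[ℝ] Seq p :=
  (conv a).comp upsample

theorem subdivision_apply {p : ℝ≥0∞} [Fact (1 ≤ p)] (a : Mask) (c : Seq p) (k : ℤ) :
    subdivision a c k = ∑' l, a (k - 2 * l) * c l := by
  have hi : Function.Injective fun l : ℤ => 2 * l := fun a b h => by simpa using h
  have h : subdivision a c k = toeplitz a (upsample c) k := rfl
  rw [h, toeplitz_apply, ← hi.tsum_eq]
  · simp [upsample_apply]
  · intro l hl
    by_contra hn
    have : ¬ Even l := fun ⟨m, hm⟩ => hn ⟨m, by simp only; omega⟩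
    simp [upsample_apply, this] at hl

/-- The decimation operator `D_g c = g * (c ↓ 2)`. -/
def decimation {p : ℝ≥0∞} [Fact (1 ≤ p)] (g : Mask) : Seq p →L[ℝ] Seq p :=
  (conv g).comp downsample

theorem decimation_apply {p : ℝ≥0∞} [Fact (1 ≤ p)] (g : Mask) (c : Seq p) (k : ℤ) :
    decimation g c k = ∑' l, g l * c (2 * (k - l)) := rfl

/-- `c` and `d` hold the approximations `c^{(0)}, …, c^{(j)}` and the details
`d^{(1)}, …, d^{(j)}` of the pyramid obtained from `c^{(j)}` by the multiscale transform:
`c^{(l-1)} = D_g c^{(l)}` and `d^{(l)} = c^{(l)} - S_a c^{(l-1)}` for `l = j, …, 1`. -/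
def IsPyramid {p : ℝ≥0∞} [Fact (1 ≤ p)] (a g : Mask) (j : ℕ) (c d : ℕ → Seq p) : Prop :=
  ∀ l ∈ Finset.Icc 1 j,
    c (l - 1) = decimation g (c l) ∧ d l = c l - subdivision a (c (l - 1))

/-! ### Symbols and inverse masks -/

/-- The symbol `a(z) = ∑_k a_k z^k`. -/
def symbol (a : Mask) (z : ℂ) : ℂ := ∑' k : ℤ, (a k : ℂ) * z ^ k

/-- `g` is the inverse of the mask `a`: `g(z) = 1 / a(z)` on the unit circle. -/
def IsInverseMask (g a : Mask) : Prop :=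
  ∀ z : ℂ, ‖z‖ = 1 → symbol g z * symbol a z = 1

/-- The finitely supported mask with a given Laurent polynomial as its symbol. -/
def maskOf (f : ℝ[T;T⁻¹]) : Mask :=
  ⟨fun k => f.coeff k, memℓp_gen <| by
    refine summable_of_ne_finset_zero (s := f.coeff.support) fun k hk => ?_
    simp [Finsupp.notMem_support_iff.1 hk]⟩

/-- The symbol of the primal pseudo-spline mask `α^{2k,ν}`:
`z^{-k} (1+z)^{2k} / 2^{2k-1} * ∑_{j=0}^ν (k+j-1 choose j) (1/2 - (z+z⁻¹)/4)^j`. -/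
def pseudoSplineSymbol (k ν : ℕ) : ℝ[T;T⁻¹] :=
  LaurentPolynomial.C (1 / 2 ^ (2 * k - 1) : ℝ) * LaurentPolynomial.T (-(k : ℤ))
    * (1 + LaurentPolynomial.T 1) ^ (2 * k)
    * ∑ j ∈ Finset.range (ν + 1), LaurentPolynomial.C ((k + j - 1).choose j : ℝ)
        * (LaurentPolynomial.C (1 / 2 : ℝ) - LaurentPolynomial.C (1 / 4 : ℝ)
            * (LaurentPolynomial.T 1 + LaurentPolynomial.T (-1))) ^ j

/-- The primal pseudo-spline mask `α^{2k,ν}`. -/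
def pseudoSplineMask (k ν : ℕ) : Mask := maskOf (pseudoSplineSymbol k ν)

/-! ### Constants -/

/-- `κ = 2^{k+ν-1} / ∑_{j=0}^ν (k+ν choose j)`. -/
def kappa (k ν : ℕ) : ℝ :=
  2 ^ (k + ν - 1) / ∑ j ∈ Finset.range (ν + 1), ((k + ν).choose j : ℝ)

/-- `λ = ((√κ - 1) / (√κ + 1))^{1/s}` with `s = ⌊(k+ν)/2⌋`. -/
def lam (k ν : ℕ) : ℝ :=
  ((√(kappa k ν) - 1) / (√(kappa k ν) + 1)) ^ (1 / (((k + ν) / 2 : ℕ) : ℝ))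

/-- `C(k,ν) = κ * max {1, (1+√κ)² / (2κ)} * (1+λ) / (1-λ)`. -/
def stabConst (k ν : ℕ) : ℝ :=
  kappa k ν * max 1 ((1 + √(kappa k ν)) ^ 2 / (2 * kappa k ν))
    * ((1 + lam k ν) / (1 - lam k ν))

end MTER

end

/-! Put y = 1/2 - (u + u⁻¹)/4, which is sin²(θ/2) for u = e^{iθ}. The pseudo-spline symbol at u is
2B(y) with B = `basicPoly k ν`, and u ↦ -u acts as y ↦ 1 - y, so the even part has symbol B(y) + B(1
- y) at u². The derivative of B is an explicit monomial in y and 1 - y, which makes this function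
decrease strictly on [0, 1/2] from 1 to 1/κ. Hence the even symbol is real with values in [1/κ, 1],
and its minimum 1/κ is attained at u² = -1.

The even mask is supported in [-s, s], so its Toeplitz matrix is banded with spectrum in [1/κ, 1].
Off-diagonal decay of the inverse follows by Chebyshev approximation
(`exists_polynomial_inv_approx`): a degree n polynomial in the symbol f has no Fourier coefficient
beyond ns, so the coefficients of 1/f there are bounded by the uniform error of approximating 1/x on
[1/κ, 1]. Summing the resulting bound (`norm_fourierCoeffCLM_inv_le`) gives existence of γ in l_1
and ‖γ‖₁ ≤ C(k,ν), which bounds D_γ on every l_p.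

On l_2, Parseval bounds the norm of A_γ by max |γ(z)| = κ, and truncated alternating sequences show
that γ(-1) = κ is a lower bound. D_γ and A_γ have equal norms, and the pyramid estimates are
iterations of the bound for D_γ. -/

namespace MTER

/-! ### Chebyshev approximation of 1/x on an interval -/

section Chebyshev

open Polynomial Polynomial.Chebyshev

theorem eval_T_half_add_inv {q : ℝ} (hq : 0 < q) (m : ℤ) :
    (T ℝ m).eval ((q + q⁻¹) / 2) = (q ^ m + (q ^ m)⁻¹) / 2 := by
  rw [← Real.cosh_log hq, T_real_cosh, ← Real.log_zpow, Real.cosh_log (zpow_pos hq m)]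

/-- The numerator of the error of best approximation to `1 / (c - t)` by polynomials. -/
noncomputable def errorPoly (q : ℝ) (n : ℕ) : ℝ[X] :=
  T ℝ (n + 1) - C (2 * q) * T ℝ n + C (q ^ 2) * T ℝ (n - 1)

theorem natDegree_errorPoly_le (q : ℝ) (n : ℕ) : (errorPoly q n).natDegree ≤ n + 1 := by
  unfold errorPoly
  refine (natDegree_add_le _ _).trans (max_le ((natDegree_sub_le _ _).trans (max_le ?_ ?_)) ?_)
  · rw [natDegree_T]; omega
  · refine (natDegree_C_mul_le _ _).trans ?_
    rw [natDegree_T]; omega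
  -- For n = 0 the index is -1 and T₋₁ = T₁, still of degree at most n + 1.
  · refine (natDegree_C_mul_le _ _).trans ?_
    rw [natDegree_T]; omega

/-- At the pole T_m equals (q^m + q^(-m))/2. The contributions of the q^m cancel, and those of the
q^(-m) leave q^(-(n+1)) (1 - q²)², which is large for small q. -/
theorem eval_errorPoly_pole {q : ℝ} (hq : 0 < q) (n : ℕ) :
    (errorPoly q n).eval ((q + q⁻¹) / 2) = (1 - q ^ 2) ^ 2 / (2 * q ^ (n + 1)) := by
  simp only [errorPoly, eval_add, eval_sub, eval_mul, eval_C, eval_T_half_add_inv hq]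
  rw [zpow_add₀ hq.ne', zpow_sub₀ hq.ne', zpow_natCast, zpow_one]
  field_simp
  ring

/-- For t = cos φ the value is the real part of e^{i(n-1)φ} (e^{iφ} - q)², whose modulus is |e^{iφ}
- q|² = 1 + q² - 2qt. With c = (q + q⁻¹)/2 this bound is 2q(c - t), so it vanishes at the pole
exactly as the denominator of 1/(c - t) does. -/
theorem abs_eval_errorPoly_le {q t : ℝ} (hq : 0 < q) (ht : |t| ≤ 1) (n : ℕ) :
    |(errorPoly q n).eval t| ≤ 1 + q ^ 2 - 2 * q * t := by
  obtain ⟨h1, h2⟩ := abs_le.1 ht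
  have h0 : 0 ≤ 1 + q ^ 2 - 2 * q * t := by nlinarith [sq_nonneg (1 - q)]
  refine abs_le_of_sq_le_sq ?_ h0
  rw [← Real.cos_arccos h1 h2]
  set φ := Real.arccos t
  simp only [errorPoly, eval_add, eval_sub, eval_mul, eval_C, T_real_cos]
  push_cast
  rw [add_mul, sub_mul, one_mul, Real.cos_add, Real.cos_sub]
  have e1 := Real.sin_sq_add_cos_sq φ
  have e2 := Real.sin_sq_add_cos_sq (n * φ)
  set a := Real.cos (n * φ)
  set b := Real.sin (n * φ)
  set x := Real.cos φ
  set y := Real.sin φ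
  -- The polynomial's value is a((1+q²)x - 2q) + b(q²-1)y, so Cauchy–Schwarz against the unit vector
  -- (a, b) suffices; the square passed to `nlinarith` is the defect in Lagrange's identity.
  have key : (1 + q ^ 2 - 2 * q * x) ^ 2
      = (((1 + q ^ 2) * x - 2 * q) ^ 2 + ((q ^ 2 - 1) * y) ^ 2) * (a ^ 2 + b ^ 2) := by
    rw [add_comm (a ^ 2), e2, mul_pow, show y ^ 2 = 1 - x ^ 2 by linarith]
    ring
  rw [key]
  nlinarith [sq_nonneg (((1 + q ^ 2) * x - 2 * q) * b - ((q ^ 2 - 1) * y) * a)]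

/-- Chebyshev's polynomial approximation of `1 / x` on `[1 / κ, 1]`. -/
theorem exists_polynomial_inv_approx {κ : ℝ} (hκ : 1 < κ) (n : ℕ) :
    ∃ p : ℝ[X], p.natDegree ≤ n ∧ ∀ x ∈ Set.Icc (1 / κ) 1,
      |1 / x - p.eval x| ≤ (1 + √κ) ^ 2 / 2 * ((√κ - 1) / (√κ + 1)) ^ (n + 1) := by
  obtain ⟨r, hr0, rfl⟩ : ∃ r : ℝ, 0 ≤ r ∧ κ = r ^ 2 :=
    ⟨√κ, Real.sqrt_nonneg _, (Real.sq_sqrt (by linarith)).symm⟩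
  rw [Real.sqrt_sq hr0]
  have hr : 1 < r := by nlinarith
  set q := (r - 1) / (r + 1) with hqdef
  have hq : 0 < q := div_pos (by linarith) (by linarith)
  have hr1 : r - 1 ≠ 0 := by linarith
  have hr2 : r + 1 ≠ 0 := by linarith
  have hrr : r ^ 2 - 1 ≠ 0 := by nlinarith
  set c := (q + q⁻¹) / 2 with hc
  have hc' : c = (r ^ 2 + 1) / (r ^ 2 - 1) := by
    rw [hc, hqdef, show r ^ 2 - 1 = (r - 1) * (r + 1) by ring]
    field_simp
    ring
  -- The affine map x ↦ c - bx sends 1/κ to 1, 1 to -1, and the singularity 0 to the pole c.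
  set b := 2 * r ^ 2 / (r ^ 2 - 1) with hb
  have hbpos : 0 < b := div_pos (by positivity) (by nlinarith)
  set M := (errorPoly q n).comp (C c - C b * X) with hM
  have hM0 : M.coeff 0 = (1 - q ^ 2) ^ 2 / (2 * q ^ (n + 1)) := by
    rw [coeff_zero_eq_eval_zero, hM, eval_comp, ← eval_errorPoly_pole hq]
    simp [hc]
  have hq1 : 1 - q ^ 2 = 4 * r / (r + 1) ^ 2 := by
    rw [hqdef]; field_simp; ring
  have hM0pos : 0 < M.coeff 0 := by
    rw [hM0, hq1]; positivity
  have hMdeg : M.natDegree ≤ n + 1 := by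
    refine natDegree_comp_le.trans ?_
    have : (C c - C b * X : ℝ[X]).natDegree ≤ 1 := by compute_degree
    calc _ ≤ (n + 1) * 1 := Nat.mul_le_mul (natDegree_errorPoly_le q n) this
      _ = n + 1 := mul_one _
  -- The approximant is (1 - M(x)/M(0))/x, a polynomial; its error is M(x)/(x M(0)).
  refine ⟨C (-(M.coeff 0)⁻¹) * divX M, (natDegree_C_mul_le _ _).trans ?_, fun x hx => ?_⟩
  · rw [natDegree_divX_eq_natDegree_tsub_one]; omega
  · have hx0 : 0 < x := lt_of_lt_of_le (by positivity) hx.1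
    have hx1 : 1 ≤ x * r ^ 2 := by
      have := hx.1; rwa [div_le_iff₀ (by positivity)] at this
    have ht : |c - b * x| ≤ 1 := by
      have hpos : 0 < r ^ 2 - 1 := by nlinarith
      rw [hc', hb, div_mul_eq_mul_div, ← sub_div, abs_div, abs_of_pos hpos,
        div_le_one hpos, abs_le]
      constructor <;> nlinarith [hx.2]
    have hsplit : M.eval x = x * (divX M).eval x + M.coeff 0 := by
      have h := congrArg (eval x) (divX_mul_X_add M)
      rw [eval_add, eval_mul, eval_X, eval_C] at h
      rw [← h, mul_comm]
    have hE : M.eval x = (errorPoly q n).eval (c - b * x) := by simp [hM]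
    have hbd := abs_eval_errorPoly_le hq ht n
    rw [← hE] at hbd
    have e1 : 1 / x - (C (-(M.coeff 0)⁻¹) * divX M).eval x = M.eval x / (x * M.coeff 0) := by
      rw [hsplit, eval_mul, eval_C]
      field_simp
      ring
    -- The bound on |M(x)| is proportional to x, so x cancels and the error bound is uniform.
    have e2 : 1 + q ^ 2 - 2 * q * (c - b * x) = 2 * q * b * x := by
      rw [hc]; field_simp; ring
    rw [e1, abs_div, abs_of_pos (mul_pos hx0 hM0pos), div_le_iff₀ (mul_pos hx0 hM0pos)]
    refine hbd.trans (le_of_eq ?_)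
    rw [e2, hM0, hq1, hb]
    have hqr : q * (r + 1) = r - 1 := by rw [hqdef]; field_simp
    have e3 : r ^ 2 - 1 = q * (r + 1) ^ 2 := by
      rw [show r ^ 2 - 1 = (r - 1) * (r + 1) by ring, ← hqr]; ring
    rw [e3]
    clear_value q
    field_simp
    ring

end Chebyshev

/-! ### The even symbol as a function of sin²(θ/2) -/

section BasicPoly

open Polynomial

/-- The pseudo-spline symbol, halved, as a polynomial in `sin² (θ / 2)`. -/
noncomputable def basicPoly (k ν : ℕ) : ℝ[X] :=
  (1 - X) ^ k * ∑ j ∈ Finset.range (ν + 1), C ((k + j - 1).choose j : ℝ) * X ^ j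

theorem natDegree_basicPoly_le (k ν : ℕ) : (basicPoly k ν).natDegree ≤ k + ν := by
  refine natDegree_mul_le.trans (add_le_add ?_ ?_)
  · have : (1 - X : ℝ[X]).natDegree ≤ 1 := by compute_degree
    calc _ ≤ k * 1 := natDegree_pow_le_of_le k this
      _ = k := mul_one k
  · refine natDegree_sum_le_of_forall_le _ _ fun j hj => ?_
    exact (natDegree_C_mul_X_pow_le _ _).trans (by simpa [Nat.lt_succ_iff] using hj)

theorem succ_mul_choose_step {k : ℕ} (hk : 1 ≤ k) (ν : ℕ) :
    ((ν : ℝ) + 1) * ((k + (ν + 1) - 1).choose (ν + 1) : ℝ)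
      = (k + ν) * ((k + ν - 1).choose ν : ℝ) := by
  obtain ⟨m, rfl⟩ : ∃ m, k = m + 1 := ⟨k - 1, by omega⟩
  have h := Nat.add_one_mul_choose_eq (m + ν) ν
  rw [show m + 1 + (ν + 1) - 1 = m + ν + 1 by omega, show m + 1 + ν - 1 = m + ν by omega]
  have h' : ((m + ν + 1 : ℕ) : ℝ) * ((m + ν).choose ν : ℝ)
      = ((m + ν + 1).choose (ν + 1) : ℝ) * ((ν + 1 : ℕ) : ℝ) := by exact_mod_cast h
  push_cast at h' ⊢
  linarith

theorem basicPoly_succ (k ν : ℕ) : basicPoly k (ν + 1)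
    = basicPoly k ν + (1 - X) ^ k * (C ((k + (ν + 1) - 1).choose (ν + 1) : ℝ) * X ^ (ν + 1)) := by
  rw [basicPoly, Finset.sum_range_succ, mul_add, basicPoly]

/-- The sum in B is the Taylor polynomial of (1 - X)^(-k), so B = 1 modulo X^(ν+1) and X^ν divides
B'; so does (1 - X)^(k-1), and the degrees leave only a constant. The formal proof is an induction
on ν, closed by the binomial recursion `succ_mul_choose_step`. -/
theorem derivative_basicPoly {k : ℕ} (hk : 1 ≤ k) (ν : ℕ) :
    derivative (basicPoly k ν)
      = -(C ((k + ν) * ((k + ν - 1).choose ν : ℝ)) * (X ^ ν * (1 - X) ^ (k - 1))) := by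
  obtain ⟨m, rfl⟩ : ∃ m, k = m + 1 := ⟨k - 1, by omega⟩
  induction ν with
  | zero =>
    simp [basicPoly, derivative_pow]
  | succ ν ih =>
    rw [basicPoly_succ, derivative_add, ih, ← succ_mul_choose_step hk]
    generalize ((m + 1 + (ν + 1) - 1).choose (ν + 1) : ℝ) = b
    simp only [derivative_mul, derivative_pow, derivative_sub, derivative_one, derivative_X,
      derivative_C, Nat.add_sub_cancel]
    simp only [C_mul, C_add, C_1, map_natCast, Nat.cast_add, Nat.cast_one]
    ring

/-- The symbol of the even part of the pseudo-spline mask, in terms of `sin² (θ / 2)`. -/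
noncomputable def evenPart (k ν : ℕ) (y : ℝ) : ℝ :=
  (basicPoly k ν).eval y + (basicPoly k ν).eval (1 - y)

theorem hasDerivAt_evenPart {k : ℕ} (hk : 1 ≤ k) (ν : ℕ) (y : ℝ) :
    HasDerivAt (evenPart k ν)
      ((k + ν) * ((k + ν - 1).choose ν : ℝ)
        * ((1 - y) ^ ν * y ^ (k - 1) - y ^ ν * (1 - y) ^ (k - 1))) y := by
  have h1 := (basicPoly k ν).hasDerivAt y
  have h2 := ((basicPoly k ν).hasDerivAt (1 - y)).comp y ((hasDerivAt_id y).const_sub 1)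
  refine (h1.add h2).congr_deriv ?_
  rw [derivative_basicPoly hk]
  simp
  ring

/-- After extracting (y(1-y))^ν, the derivative has the sign of y^(k-1-ν) - (1-y)^(k-1-ν). The
condition ν ≤ k - 2 makes this exponent positive, hence the sign strict. -/
theorem strictAntiOn_evenPart {k ν : ℕ} (hk : 2 ≤ k) (hν : ν ≤ k - 2) :
    StrictAntiOn (evenPart k ν) (Set.Icc 0 (1 / 2)) := by
  refine strictAntiOn_of_deriv_neg (convex_Icc _ _) ?_ fun y hy => ?_
  · exact fun y _ => (hasDerivAt_evenPart (by omega) ν y).continuousAt.continuousWithinAt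
  · rw [interior_Icc] at hy
    have hy0 : 0 < y := hy.1
    have hy1 : y < 1 - y := by have := hy.2; linarith
    rw [(hasDerivAt_evenPart (by omega) ν y).deriv]
    have hc : 0 < ((k + ν - 1).choose ν : ℝ) := by
      exact_mod_cast Nat.choose_pos (by omega)
    have hk0 : (0 : ℝ) < k := by exact_mod_cast (by omega : 0 < k)
    refine mul_neg_of_pos_of_neg (by positivity) ?_
    have e : k - 1 = ν + (k - 1 - ν) := by omega
    have hlt : y ^ (k - 1 - ν) < (1 - y) ^ (k - 1 - ν) :=
      pow_lt_pow_left₀ hy1 hy0.le (by omega)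
    rw [e, pow_add, pow_add]
    have hpos : 0 < y ^ ν * (1 - y) ^ ν := by
      have : 0 < 1 - y := by linarith
      positivity
    nlinarith [mul_pos hpos (sub_pos.2 hlt)]

theorem evenPart_one_sub (k ν : ℕ) (y : ℝ) : evenPart k ν (1 - y) = evenPart k ν y := by
  simp [evenPart, add_comm]

theorem evenPart_zero {k : ℕ} (hk : 1 ≤ k) (ν : ℕ) : evenPart k ν 0 = 1 := by
  have : k ≠ 0 := by omega
  simp [evenPart, basicPoly, eval_finsetSum, this, Finset.sum_range_succ']

theorem evenPart_mem_Icc {k ν : ℕ} (hk : 2 ≤ k) (hν : ν ≤ k - 2) {y : ℝ}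
    (hy : y ∈ Set.Icc (0 : ℝ) 1) : evenPart k ν y ∈ Set.Icc (evenPart k ν (1 / 2)) 1 := by
  have key : ∀ y ∈ Set.Icc (0 : ℝ) (1 / 2),
      evenPart k ν y ∈ Set.Icc (evenPart k ν (1 / 2)) 1 := fun y hy => by
    have h := (strictAntiOn_evenPart hk hν).antitoneOn
    refine ⟨h hy (by norm_num) hy.2, ?_⟩
    rw [← evenPart_zero (by omega : 1 ≤ k) ν]
    exact h (by norm_num) hy hy.1
  rcases le_total y (1 / 2) with h | h
  · exact key y ⟨hy.1, h⟩
  · rw [← evenPart_one_sub k ν y]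
    exact key (1 - y) ⟨by linarith [hy.2], by linarith⟩

/-- This converts the value of B at 1/2 into the denominator of κ. Raising ν by one doubles the
right side up to a boundary term, by Pascal's rule. -/
theorem sum_choose_mul_half_pow {k : ℕ} (hk : 1 ≤ k) (ν : ℕ) :
    2 ^ ν * ∑ j ∈ Finset.range (ν + 1), ((k + j - 1).choose j : ℝ) * (1 / 2) ^ j
      = ∑ j ∈ Finset.range (ν + 1), ((k + ν).choose j : ℝ) := by
  induction ν with
  | zero => simp
  | succ ν ih =>
    have h1 : ∑ j ∈ Finset.range (ν + 1 + 1), ((k + (ν + 1)).choose j : ℝ)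
        = ∑ j ∈ Finset.range (ν + 1), ((k + ν).choose j : ℝ)
          + ∑ j ∈ Finset.range (ν + 1 + 1), ((k + ν).choose j : ℝ) := by
      rw [Finset.sum_range_succ', Finset.sum_range_succ' _ (ν + 1), ← add_assoc,
        ← add_assoc, ← Finset.sum_add_distrib]
      simp [Nat.choose_succ_succ]
    rw [h1, Finset.sum_range_succ _ (ν + 1), Finset.sum_range_succ _ (ν + 1), ← ih, mul_add,
      show k + (ν + 1) - 1 = k + ν by omega]
    have h2 : (2 : ℝ) ^ (ν + 1) * (1 / 2) ^ (ν + 1) = 1 := by rw [← mul_pow]; norm_num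
    linear_combination ((k + ν).choose (ν + 1) : ℝ) * h2

theorem evenPart_half {k : ℕ} (hk : 1 ≤ k) (ν : ℕ) :
    evenPart k ν (1 / 2) = 1 / kappa k ν := by
  have h := sum_choose_mul_half_pow hk ν
  rw [kappa, one_div_div, ← h, evenPart, show (1 : ℝ) - 1 / 2 = 1 / 2 by norm_num]
  simp only [basicPoly, eval_mul, eval_pow, eval_sub, eval_one, eval_X, eval_finsetSum, eval_C]
  obtain ⟨m, rfl⟩ : ∃ m, k = m + 1 := ⟨k - 1, by omega⟩
  rw [show m + 1 + ν - 1 = m + ν by omega, show (1 : ℝ) - 1 / 2 = 1 / 2 by norm_num, pow_add]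
  generalize ∑ j ∈ Finset.range (ν + 1), ((m + 1 + j - 1).choose j : ℝ) * (1 / 2) ^ j = S
  rw [one_div, inv_pow]
  field_simp
  ring

theorem one_lt_kappa {k ν : ℕ} (hk : 2 ≤ k) (hν : ν ≤ k - 2) : 1 < kappa k ν := by
  have h := strictAntiOn_evenPart hk hν (a := 0) (b := 1 / 2) (by norm_num) (by norm_num)
    (by norm_num)
  rw [evenPart_zero (by omega), evenPart_half (by omega)] at h
  have hpos : 0 < kappa k ν := by
    refine div_pos (by positivity) (Finset.sum_pos (fun j hj => ?_) ⟨0, by simp⟩)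
    have : j < ν + 1 := by simpa using hj
    exact_mod_cast Nat.choose_pos (by omega)
  rwa [div_lt_one hpos] at h

end BasicPoly

/-! ### Fourier coefficients, symbols and decay of the inverse mask -/

section Fourier

open MeasureTheory AddCircle ComplexConjugate

theorem fourier_eq_zpow (n : ℤ) (x : UnitAddCircle) :
    fourier n x = (fourier 1 x : ℂ) ^ n := by
  rw [fourier_apply, fourier_one, AddCircle.toCircle_zsmul, Circle.coe_zpow]

theorem norm_fourier_apply (n : ℤ) (x : UnitAddCircle) : ‖fourier n x‖ = 1 := by
  rw [fourier_apply]; exact Circle.norm_coe _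

theorem exists_fourier_one_eq {z : ℂ} (hz : ‖z‖ = 1) :
    ∃ x : UnitAddCircle, fourier 1 x = z := by
  refine ⟨((z.arg / (2 * Real.pi) : ℝ) : UnitAddCircle), ?_⟩
  rw [fourier_coe_apply]
  conv_rhs => rw [← Complex.norm_mul_exp_arg_mul_I z, hz]
  push_cast
  rw [one_mul]
  congr 1
  have := Real.pi_ne_zero
  field_simp

theorem integrable_haarAddCircle (f : C(UnitAddCircle, ℂ)) :
    Integrable f (haarAddCircle (T := 1)) :=
  f.continuous.integrable_of_hasCompactSupport (HasCompactSupport.of_compactSpace _)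

/-- The `n`-th Fourier coefficient as a continuous functional on continuous functions. -/
noncomputable def fourierCoeffCLM (n : ℤ) : C(UnitAddCircle, ℂ) →L[ℂ] ℂ :=
  LinearMap.mkContinuous
    { toFun := fun f => fourierCoeff f n
      map_add' := fun f g => by
        rw [ContinuousMap.coe_add, fourierCoeff.add (integrable_haarAddCircle f)
          (integrable_haarAddCircle g), Pi.add_apply]
      map_smul' := fun c f => by
        rw [ContinuousMap.coe_smul, fourierCoeff.const_smul, RingHom.id_apply] } 1 (fun f => by
    have h := norm_integral_le_of_norm_le_const (μ := haarAddCircle (T := 1)) (C := ‖f‖)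
      (f := fun t => fourier (-n) t • f t) (Filter.Eventually.of_forall fun t => by
        rw [norm_smul, norm_fourier_apply, one_mul]; exact f.norm_coe_le_norm t)
    simpa [fourierCoeff] using h)

theorem fourierCoeffCLM_apply (n : ℤ) (f : C(UnitAddCircle, ℂ)) :
    fourierCoeffCLM n f = fourierCoeff f n := rfl

theorem norm_fourierCoeffCLM_le (n : ℤ) (f : C(UnitAddCircle, ℂ)) :
    ‖fourierCoeffCLM n f‖ ≤ ‖f‖ := by
  simpa using (fourierCoeffCLM n).le_of_opNorm_le
    (LinearMap.mkContinuous_norm_le _ zero_le_one _) f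

theorem fourierCoeffCLM_fourier (n m : ℤ) :
    fourierCoeffCLM n (fourier m) = if n = m then 1 else 0 := by
  rw [fourierCoeffCLM_apply, fourierCoeff_fourier, Pi.single_apply]

theorem fourierCoeffCLM_mul_fourier (n m : ℤ) (f : C(UnitAddCircle, ℂ)) :
    fourierCoeffCLM n (f * fourier m) = fourierCoeffCLM (n - m) f := by
  rw [fourierCoeffCLM_apply, fourierCoeffCLM_apply, fourierCoeff, fourierCoeff]
  refine integral_congr_ae (Filter.Eventually.of_forall fun t => ?_)
  change fourier (-n) t * (f t * fourier m t) = fourier (-(n - m)) t * f t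
  rw [show -(n - m) = -n + m by ring, fourier_add]
  ring

theorem hasSum_sq_fourierCoeffCLM (f : C(UnitAddCircle, ℂ)) :
    HasSum (fun n => ‖fourierCoeffCLM n f‖ ^ 2) (∫ t, ‖f t‖ ^ 2 ∂(haarAddCircle (T := 1))) := by
  have h := hasSum_sq_fourierCoeff (ContinuousMap.toLp (E := ℂ) 2 (haarAddCircle (T := 1)) ℂ f)
  simp_rw [fourierCoeff_toLp] at h
  have e := ContinuousMap.coeFn_toLp (p := 2) (𝕜 := ℂ) (haarAddCircle (T := 1)) f
  have e' : ∫ t, ‖ContinuousMap.toLp (E := ℂ) 2 (haarAddCircle (T := 1)) ℂ f t‖ ^ 2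
      ∂(haarAddCircle (T := 1)) = ∫ t, ‖f t‖ ^ 2 ∂(haarAddCircle (T := 1)) :=
    integral_congr_ae (e.mono fun t ht => congrArg (fun w : ℂ => ‖w‖ ^ 2) ht)
  rwa [e'] at h

/-! ### Trigonometric polynomials -/

/-- Trigonometric polynomials of degree at most `d`. -/
noncomputable def trigPoly (d : ℕ) : Submodule ℂ C(UnitAddCircle, ℂ) :=
  Submodule.span ℂ ((fun j : ℤ => fourier j) '' {j | |j| ≤ d})

theorem fourier_mem_trigPoly {j : ℤ} {d : ℕ} (h : |j| ≤ d) : fourier j ∈ trigPoly d :=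
  Submodule.subset_span ⟨j, h, rfl⟩

theorem trigPoly_mono {d e : ℕ} (h : d ≤ e) : trigPoly d ≤ trigPoly e :=
  Submodule.span_mono (Set.image_mono fun _ hj =>
    le_trans (b := (d : ℤ)) hj (by exact_mod_cast h : (d : ℤ) ≤ e))

theorem one_mem_trigPoly (d : ℕ) : (1 : C(UnitAddCircle, ℂ)) ∈ trigPoly d := by
  have : (1 : C(UnitAddCircle, ℂ)) = fourier 0 := by
    ext x; exact fourier_zero.symm
  rw [this]
  exact fourier_mem_trigPoly (by simp)

theorem mul_mem_trigPoly {d e : ℕ} {f g : C(UnitAddCircle, ℂ)} (hf : f ∈ trigPoly d)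
    (hg : g ∈ trigPoly e) : f * g ∈ trigPoly (d + e) := by
  have h := Submodule.mul_mem_mul hf hg
  rw [trigPoly, trigPoly, Submodule.span_mul_span] at h
  refine Submodule.span_le.2 ?_ h
  rintro _ ⟨_, ⟨i, hi, rfl⟩, _, ⟨j, hj, rfl⟩, rfl⟩
  have : (fourier i * fourier j : C(UnitAddCircle, ℂ)) = fourier (i + j) := by
    ext x; exact fourier_add.symm
  change fourier i * fourier j ∈ trigPoly (d + e)
  rw [this]
  refine fourier_mem_trigPoly ((abs_add_le i j).trans ?_)
  push_cast
  exact add_le_add hi hj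

theorem pow_mem_trigPoly {d : ℕ} {f : C(UnitAddCircle, ℂ)} (hf : f ∈ trigPoly d) (n : ℕ) :
    f ^ n ∈ trigPoly (n * d) := by
  induction n with
  | zero => simpa using one_mem_trigPoly 0
  | succ n ih =>
    rw [pow_succ, Nat.succ_mul]
    exact mul_mem_trigPoly ih hf

/-- The function counterpart of bandwidth growth: a degree n polynomial in a banded matrix widens
the band at most n times. -/
theorem aeval_mem_trigPoly {d n : ℕ} {f : C(UnitAddCircle, ℂ)} (hf : f ∈ trigPoly d)
    {p : Polynomial ℝ} (hp : p.natDegree ≤ n) : Polynomial.aeval f p ∈ trigPoly (n * d) := by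
  rw [Polynomial.aeval_eq_sum_range]
  refine Submodule.sum_mem _ fun i hi => Submodule.smul_of_tower_mem _ _ ?_
  refine trigPoly_mono (Nat.mul_le_mul_right d ?_) (pow_mem_trigPoly hf i)
  have := Finset.mem_range.1 hi
  omega

theorem aeval_continuousMap_apply (p : Polynomial ℝ) (f : C(UnitAddCircle, ℂ)) (x : UnitAddCircle) :
    Polynomial.aeval f p x = Polynomial.aeval (f x) p := by
  rw [Polynomial.aeval_eq_sum_range, Polynomial.aeval_eq_sum_range, ContinuousMap.sum_apply]
  rfl

theorem fourierCoeffCLM_eq_zero {d : ℕ} {f : C(UnitAddCircle, ℂ)} (hf : f ∈ trigPoly d) {m : ℤ}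
    (hm : (d : ℤ) < |m|) : fourierCoeffCLM m f = 0 := by
  have : trigPoly d ≤ LinearMap.ker (fourierCoeffCLM m).toLinearMap := by
    refine Submodule.span_le.2 ?_
    rintro _ ⟨j, hj, rfl⟩
    have hne : m ≠ j := by
      rintro rfl
      exact absurd hj (not_le.2 hm)
    change fourierCoeffCLM m (fourier j) = 0
    rw [fourierCoeffCLM_fourier, if_neg hne]
  exact this hf

/-! ### Symbols as continuous functions -/

theorem hasSum_norm_mask (a : Mask) : HasSum (fun l => ‖a l‖) ‖a‖ := by
  have h := lp.hasSum_norm (p := 1) (by simp) a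
  simpa only [ENNReal.toReal_one, Real.rpow_one] using h

theorem summable_smul_fourier (a : Mask) :
    Summable fun m : ℤ => (a m : ℂ) • (fourier m : C(UnitAddCircle, ℂ)) := by
  refine Summable.of_norm ?_
  simp_rw [norm_smul, fourier_norm, mul_one, Complex.norm_real]
  exact (hasSum_norm_mask a).summable

/-- The symbol of a mask as a continuous function on the circle. -/
noncomputable def symbolMap (a : Mask) : C(UnitAddCircle, ℂ) :=
  ∑' m : ℤ, (a m : ℂ) • fourier m

theorem hasSum_symbolMap (a : Mask) (x : UnitAddCircle) :
    HasSum (fun m : ℤ => (a m : ℂ) * fourier m x) (symbolMap a x) :=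
  (ContinuousMap.evalCLM ℂ x).hasSum (summable_smul_fourier a).hasSum

theorem symbolMap_apply (a : Mask) (x : UnitAddCircle) :
    symbolMap a x = symbol a (fourier 1 x) := by
  rw [← (hasSum_symbolMap a x).tsum_eq, symbol]
  exact tsum_congr fun m => by rw [fourier_eq_zpow m x]

theorem fourierCoeffCLM_symbolMap (a : Mask) (n : ℤ) :
    fourierCoeffCLM n (symbolMap a) = a n := by
  have h := (fourierCoeffCLM n).hasSum (summable_smul_fourier a).hasSum
  refine h.unique ?_
  simp_rw [map_smul, fourierCoeffCLM_fourier, smul_eq_mul, mul_ite, mul_one, mul_zero]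
  convert! hasSum_ite_eq n (a n : ℂ) using 2 with m
  by_cases hm : m = n
  · rw [if_pos hm, if_pos hm.symm, hm]
  · rw [if_neg hm, if_neg (Ne.symm hm)]

theorem symbolMap_injective : Function.Injective symbolMap := fun a b h => by
  apply lp.ext
  funext n
  have := congrArg (fourierCoeffCLM n) h
  rw [fourierCoeffCLM_symbolMap, fourierCoeffCLM_symbolMap] at this
  exact_mod_cast this

/-- Masks are real; this symmetry is later what forces the inverse mask to be real. -/
theorem symbolMap_neg (a : Mask) (x : UnitAddCircle) :
    symbolMap a (-x) = conj (symbolMap a x) := by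
  refine (hasSum_symbolMap a (-x)).unique ?_
  convert! (Complex.hasSum_conj'.2 (hasSum_symbolMap a x)) using 2 with m
  rw [map_mul, Complex.conj_ofReal, ← fourier_neg, fourier_apply, fourier_apply, zsmul_neg,
    neg_zsmul]

theorem symbolMap_mem_trigPoly {a : Mask} {d : ℕ} (ha : ∀ m : ℤ, (d : ℤ) < |m| → a m = 0) :
    symbolMap a ∈ trigPoly d := by
  rw [symbolMap, tsum_eq_sum (s := Finset.Icc (-(d : ℤ)) d) fun m hm => by
    rw [ha m (by rw [Finset.mem_Icc, ← abs_le] at hm; exact not_le.1 hm), Complex.ofReal_zero]; exact zero_smul ℂ (fourier m)]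
  exact Submodule.sum_mem _ fun m hm => Submodule.smul_mem _ _
    (fourier_mem_trigPoly (abs_le.2 (Finset.mem_Icc.1 hm)))

theorem isInverseMask_iff {g a : Mask} : IsInverseMask g a ↔ symbolMap g * symbolMap a = 1 := by
  constructor
  · intro h
    ext x
    rw [ContinuousMap.mul_apply, symbolMap_apply, symbolMap_apply]
    exact h _ (norm_fourier_apply 1 x)
  · intro h z hz
    obtain ⟨x, rfl⟩ := exists_fourier_one_eq hz
    rw [← symbolMap_apply, ← symbolMap_apply, ← ContinuousMap.mul_apply, h]
    rfl

/-! ### Exponential decay of the inverse mask -/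

/-- The bound on the entry of index `m` of the inverse of a banded Toeplitz matrix with
half-bandwidth `s` and condition number `κ`. -/
noncomputable def decayBound (κ : ℝ) (s : ℕ) (m : ℤ) : ℝ :=
  κ * max 1 ((1 + √κ) ^ 2 / (2 * κ))
    * (((√κ - 1) / (√κ + 1)) ^ (1 / (s : ℝ))) ^ m.natAbs

theorem decayRate_mem_Ioo {κ : ℝ} (hκ : 1 < κ) {s : ℕ} (hs : 1 ≤ s) :
    ((√κ - 1) / (√κ + 1)) ^ (1 / (s : ℝ)) ∈ Set.Ioo (0 : ℝ) 1 := by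
  have h1 : 1 < √κ := Real.lt_sqrt_of_sq_lt (by simpa using hκ)
  have h0 : 0 < (√κ - 1) / (√κ + 1) := div_pos (by linarith) (by linarith)
  refine ⟨Real.rpow_pos_of_pos h0 _, Real.rpow_lt_one h0.le ?_ (by positivity)⟩
  rw [div_lt_one (by linarith)]
  linarith

theorem hasSum_pow_natAbs {t : ℝ} (ht : t ∈ Set.Ioo (0 : ℝ) 1) :
    HasSum (fun m : ℤ => t ^ m.natAbs) ((1 + t) / (1 - t)) := by
  have h := hasSum_geometric_of_lt_one ht.1.le ht.2
  have h1 : 1 - t ≠ 0 := by linarith [ht.2]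
  convert! HasSum.of_nat_of_neg_add_one (f := fun m : ℤ => t ^ m.natAbs) (m := (1 - t)⁻¹)
    (m' := t * (1 - t)⁻¹) (by simpa using h) ?_ using 1
  · field_simp
  · convert! h.mul_left t using 2 with n
    rw [← pow_succ', show (-((n : ℤ) + 1)).natAbs = n + 1 by omega]

/-- For m ≠ 0, subtracting from g = 1/f a polynomial in f of band less than |m| does not change the
m-th coefficient, which is then at most the Chebyshev error. For m = 0 no polynomial can be
discarded and the bound is ‖g‖ ≤ κ, whence the maximum with 1 in the constant. -/
theorem norm_fourierCoeffCLM_inv_le {κ : ℝ} (hκ : 1 < κ) {s : ℕ} (hs : 1 ≤ s)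
    {f g : C(UnitAddCircle, ℂ)} (hf : f ∈ trigPoly s)
    (hr : ∀ x, ∃ r ∈ Set.Icc (1 / κ) 1, f x = ((r : ℝ) : ℂ)) (hg : g * f = 1) (m : ℤ) :
    ‖fourierCoeffCLM m g‖ ≤ decayBound κ s m := by
  have hκ0 : 0 < κ := by linarith
  obtain ⟨hl0, hl1⟩ := decayRate_mem_Ioo hκ hs
  have h1 : 1 < √κ := Real.lt_sqrt_of_sq_lt (by simpa using hκ)
  have hq0 : 0 < (√κ - 1) / (√κ + 1) := div_pos (by linarith) (by linarith)
  have hgx : ∀ x, ∃ r ∈ Set.Icc (1 / κ) 1, f x = ((r : ℝ) : ℂ) ∧ g x = ((1 / r : ℝ) : ℂ) := by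
    intro x
    obtain ⟨r, hr, hx⟩ := hr x
    have h := congrArg (fun F : C(UnitAddCircle, ℂ) => F x) hg
    simp only [ContinuousMap.mul_apply, ContinuousMap.one_apply] at h
    refine ⟨r, hr, hx, ?_⟩
    rw [hx] at h
    rw [eq_div_of_mul_eq (right_ne_zero_of_mul_eq_one h) h]
    push_cast
    rfl
  by_cases hm : m = 0
  · subst hm
    refine (norm_fourierCoeffCLM_le 0 g).trans ?_
    have : ‖g‖ ≤ κ := by
      refine (ContinuousMap.norm_le _ hκ0.le).2 fun x => ?_
      obtain ⟨r, hr, -, hx⟩ := hgx x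
      have hr0 : 0 < r := lt_of_lt_of_le (by positivity) hr.1
      rw [hx, Complex.norm_real, Real.norm_of_nonneg (by positivity)]
      exact (one_div_le hr0 hκ0).2 hr.1
    refine this.trans ?_
    rw [decayBound, Int.natAbs_zero, pow_zero, mul_one]
    exact le_mul_of_one_le_right hκ0.le (le_max_left _ _)
  -- This is the largest n with ns < |m|. Then also |m| ≤ (n+1)s, which turns the rate q^(n+1) =
  -- λ^((n+1)s) into at most λ^|m|.
  · set n := (m.natAbs - 1) / s with hn
    have hpos : 0 < m.natAbs := Int.natAbs_pos.2 hm
    obtain ⟨p, hp, happ⟩ := exists_polynomial_inv_approx hκ n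
    have hlow : n * s ≤ m.natAbs - 1 := Nat.div_mul_le_self _ _
    have hupp : m.natAbs ≤ (n + 1) * s := by
      have := Nat.lt_mul_div_succ (m.natAbs - 1) hs
      rw [← hn, mul_comm] at this
      omega
    have hz : fourierCoeffCLM m (Polynomial.aeval f p) = 0 := by
      refine fourierCoeffCLM_eq_zero (aeval_mem_trigPoly hf hp) ?_
      rw [Int.abs_eq_natAbs]
      exact_mod_cast (by omega : n * s < m.natAbs)
    have hsub : fourierCoeffCLM m g = fourierCoeffCLM m (g - Polynomial.aeval f p) := by
      rw [map_sub, hz, sub_zero]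
    rw [hsub]
    refine (norm_fourierCoeffCLM_le _ _).trans ?_
    have hnorm : ‖g - Polynomial.aeval f p‖
        ≤ (1 + √κ) ^ 2 / 2 * ((√κ - 1) / (√κ + 1)) ^ (n + 1) := by
      refine (ContinuousMap.norm_le _ (by positivity)).2 fun x => ?_
      obtain ⟨r, hr, hfx, hx⟩ := hgx x
      have e : (Polynomial.aeval ((r : ℝ) : ℂ) p) = ((p.eval r : ℝ) : ℂ) := by
        exact Polynomial.aeval_algebraMap_apply_eq_algebraMap_eval r p
      rw [ContinuousMap.sub_apply, aeval_continuousMap_apply, hfx, hx, e, ← Complex.ofReal_sub,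
        Complex.norm_real]
      exact happ r hr
    refine hnorm.trans ?_
    rw [decayBound]
    refine mul_le_mul ?_ ?_ (by positivity) (by positivity)
    · calc (1 + √κ) ^ 2 / 2 = κ * ((1 + √κ) ^ 2 / (2 * κ)) := by field_simp
        _ ≤ _ := mul_le_mul_of_nonneg_left (le_max_right _ _) hκ0.le
    · have hs0 : (s : ℝ) ≠ 0 := by positivity
      have e : (√κ - 1) / (√κ + 1) = (((√κ - 1) / (√κ + 1)) ^ (1 / (s : ℝ))) ^ s := by
        rw [← Real.rpow_natCast, ← Real.rpow_mul hq0.le, one_div_mul_cancel hs0, Real.rpow_one]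
      calc ((√κ - 1) / (√κ + 1)) ^ (n + 1)
          = (((√κ - 1) / (√κ + 1)) ^ (1 / (s : ℝ))) ^ ((n + 1) * s) := by
            conv_lhs => rw [e]
            rw [← pow_mul, mul_comm]
        _ ≤ _ := pow_le_pow_of_le_one hl0.le hl1.le hupp

theorem hasSum_decayBound {κ : ℝ} (hκ : 1 < κ) {s : ℕ} (hs : 1 ≤ s) :
    HasSum (decayBound κ s) (κ * max 1 ((1 + √κ) ^ 2 / (2 * κ))
      * ((1 + ((√κ - 1) / (√κ + 1)) ^ (1 / (s : ℝ)))
        / (1 - ((√κ - 1) / (√κ + 1)) ^ (1 / (s : ℝ))))) :=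
  (hasSum_pow_natAbs (decayRate_mem_Ioo hκ hs)).mul_left _

theorem norm_inverseMask_le {κ : ℝ} (hκ : 1 < κ) {s : ℕ} (hs : 1 ≤ s) {a g : Mask}
    (ha : ∀ m : ℤ, (s : ℤ) < |m| → a m = 0)
    (hr : ∀ z : ℂ, ‖z‖ = 1 → ∃ r ∈ Set.Icc (1 / κ) 1, symbol a z = ((r : ℝ) : ℂ))
    (hg : IsInverseMask g a) :
    ‖g‖ ≤ κ * max 1 ((1 + √κ) ^ 2 / (2 * κ))
      * ((1 + ((√κ - 1) / (√κ + 1)) ^ (1 / (s : ℝ)))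
        / (1 - ((√κ - 1) / (√κ + 1)) ^ (1 / (s : ℝ)))) := by
  refine hasSum_le (fun m => ?_) (hasSum_norm_mask g) (hasSum_decayBound hκ hs)
  have h := norm_fourierCoeffCLM_inv_le hκ hs (symbolMap_mem_trigPoly ha)
    (fun x => by rw [symbolMap_apply]; exact hr _ (norm_fourier_apply 1 x))
    (isInverseMask_iff.1 hg) m
  rwa [fourierCoeffCLM_symbolMap, Complex.norm_real] at h

/-- The decay bound makes the Fourier coefficients of 1/f summable, so they form a mask without
recourse to Wiener's lemma. Uniqueness holds because a mask is recovered from its symbol. -/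
theorem existsUnique_inverseMask {κ : ℝ} (hκ : 1 < κ) {s : ℕ} (hs : 1 ≤ s) {a : Mask}
    (ha : ∀ m : ℤ, (s : ℤ) < |m| → a m = 0)
    (hr : ∀ z : ℂ, ‖z‖ = 1 → ∃ r ∈ Set.Icc (1 / κ) 1, symbol a z = ((r : ℝ) : ℂ)) :
    ∃! g : Mask, IsInverseMask g a := by
  have hr' : ∀ x, ∃ r ∈ Set.Icc (1 / κ) 1, symbolMap a x = ((r : ℝ) : ℂ) := fun x => by
    rw [symbolMap_apply]; exact hr _ (norm_fourier_apply 1 x)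
  have hne : ∀ x, symbolMap a x ≠ 0 := fun x => by
    obtain ⟨r, hr, hx⟩ := hr' x
    have : 0 < r := lt_of_lt_of_le (by positivity) hr.1
    rw [hx]
    exact_mod_cast this.ne'
  set g : C(UnitAddCircle, ℂ) := ⟨fun x => (symbolMap a x)⁻¹,
    (symbolMap a).continuous.inv₀ hne⟩ with hgdef
  have hgx : ∀ x, g x = (symbolMap a x)⁻¹ := fun _ => rfl
  have hg : g * symbolMap a = 1 := by
    ext x
    exact inv_mul_cancel₀ (hne x)
  have hle : ∀ m, ‖fourierCoeffCLM m g‖ ≤ decayBound κ s m :=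
    norm_fourierCoeffCLM_inv_le hκ hs (symbolMap_mem_trigPoly ha) hr' hg
  have hsum : Summable fun m => fourierCoeffCLM m g :=
    Summable.of_norm_bounded (hasSum_decayBound hκ hs).summable hle
  have hmem : Memℓp (E := fun _ : ℤ => ℝ) (fun m => (fourierCoeffCLM m g).re) 1 := by
    refine memℓp_gen ?_
    simp only [ENNReal.toReal_one, Real.rpow_one]
    exact Summable.of_nonneg_of_le (fun _ => norm_nonneg _)
      (fun m => Complex.abs_re_le_norm _) hsum.norm
  have hsymm : symbolMap ⟨_, hmem⟩ = g := by
    ext x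
    have h1 : HasSum (fun m => fourierCoeffCLM m g * fourier m x) (g x) :=
      has_pointwise_sum_fourier_series_of_summable hsum x
    -- Since g(-x) is the conjugate of g(x), the conjugated coefficients also sum to g; averaging
    -- the two series gives the real parts.
    have h2 : HasSum (fun m => conj (fourierCoeffCLM m g) * fourier m x) (g x) := by
      have h := Complex.hasSum_conj'.2
        (has_pointwise_sum_fourier_series_of_summable hsum (-x))
      have e : conj (g (-x)) = g x := by
        rw [hgx, hgx, symbolMap_neg, map_inv₀, Complex.conj_conj]
      rw [e] at h
      convert! h using 2 with m
      rw [smul_eq_mul, map_mul, ← fourier_neg, fourier_apply, fourier_apply, zsmul_neg,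
        neg_zsmul, neg_neg]
      rfl
    refine (hasSum_symbolMap _ x).unique ?_
    convert! (h1.add h2).div_const 2 using 1
    · funext m
      change (((fourierCoeffCLM m g).re : ℝ) : ℂ) * _ = _
      rw [Complex.re_eq_add_conj]
      ring
    · ring
  refine ⟨⟨_, hmem⟩, isInverseMask_iff.2 (by rw [hsymm, hg]), fun g' hg' => ?_⟩
  apply symbolMap_injective
  rw [hsymm]
  ext x
  have h := congrArg (fun F : C(UnitAddCircle, ℂ) => F x) (isInverseMask_iff.1 hg')
  simp only [ContinuousMap.mul_apply, ContinuousMap.one_apply] at h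
  rw [hgx, eq_inv_of_mul_eq_one_left h]

end Fourier

/-! ### Operator norms of Toeplitz and decimation operators -/

section OperatorNorm

open MeasureTheory AddCircle ComplexConjugate

theorem norm_conv_le {p : ℝ≥0∞} [Fact (1 ≤ p)] (a : Mask) :
    ‖(conv a : Seq p →L[ℝ] Seq p)‖ ≤ ‖a‖ :=
  LinearMap.mkContinuous_norm_le _ (norm_nonneg _) _

theorem norm_downsample_le {p : ℝ≥0∞} [Fact (1 ≤ p)] :
    ‖(downsample : Seq p →L[ℝ] Seq p)‖ ≤ 1 :=
  LinearMap.mkContinuous_norm_le _ zero_le_one _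

theorem norm_upsample_le {p : ℝ≥0∞} [Fact (1 ≤ p)] :
    ‖(upsample : Seq p →L[ℝ] Seq p)‖ ≤ 1 :=
  LinearMap.mkContinuous_norm_le _ zero_le_one _

theorem downsample_upsample {p : ℝ≥0∞} [Fact (1 ≤ p)] (c : Seq p) :
    downsample (upsample c) = c := by
  apply lp.ext
  funext k
  simp [downsample_apply, upsample_apply]

/-- Downsampling and its right inverse, upsampling, are both contractions, so each operator factors
through the other without loss. -/
theorem norm_decimation_eq {p : ℝ≥0∞} [Fact (1 ≤ p)] (g : Mask) :
    ‖(decimation g : Seq p →L[ℝ] Seq p)‖ = ‖(toeplitz g : Seq p →L[ℝ] Seq p)‖ := by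
  apply le_antisymm
  · calc _ ≤ ‖(toeplitz g : Seq p →L[ℝ] Seq p)‖ * ‖(downsample : Seq p →L[ℝ] Seq p)‖ :=
        ContinuousLinearMap.opNorm_comp_le _ _
      _ ≤ _ := mul_le_of_le_one_right (norm_nonneg _) norm_downsample_le
  · have h : (toeplitz g : Seq p →L[ℝ] Seq p) = (decimation g).comp upsample := by
      ext1 c
      change conv g c = conv g (downsample (upsample c))
      rw [downsample_upsample]
    rw [h]
    calc _ ≤ ‖(decimation g : Seq p →L[ℝ] Seq p)‖ * ‖(upsample : Seq p →L[ℝ] Seq p)‖ :=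
        ContinuousLinearMap.opNorm_comp_le _ _
      _ ≤ _ := mul_le_of_le_one_right (norm_nonneg _) norm_upsample_le

theorem hasSum_sq_norm (c : Seq 2) : HasSum (fun n => ‖c n‖ ^ 2) (‖c‖ ^ 2) := by
  have h := lp.hasSum_norm (p := 2) (by simp) c
  simpa only [ENNReal.toReal_ofNat, Real.rpow_ofNat] using h

theorem sum_single_apply (S : Finset ℤ) (f : ℤ → ℝ) (n : ℤ) :
    (∑ i ∈ S, lp.single 2 i (f i) : Seq 2) n = if n ∈ S then f n else 0 := by
  have : (∑ i ∈ S, lp.single 2 i (f i) : Seq 2) n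
      = ∑ i ∈ S, (lp.single 2 i (f i) : Seq 2) n := by
    rw [lp.coeFn_sum, Finset.sum_apply]
  rw [this]
  simp [lp.single_apply, Pi.single_apply]

/-- The trigonometric polynomial with finitely many given coefficients. -/
noncomputable def finiteSymbol (S : Finset ℤ) (f : ℤ → ℝ) : C(UnitAddCircle, ℂ) :=
  ∑ i ∈ S, (f i : ℂ) • fourier i

theorem fourierCoeffCLM_finiteSymbol (S : Finset ℤ) (f : ℤ → ℝ) (n : ℤ) :
    fourierCoeffCLM n (finiteSymbol S f)
      = ((∑ i ∈ S, lp.single 2 i (f i) : Seq 2) n : ℝ) := by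
  rw [sum_single_apply, finiteSymbol, map_sum]
  simp_rw [map_smul, fourierCoeffCLM_fourier, smul_eq_mul, mul_ite, mul_one, mul_zero]
  rw [Finset.sum_ite_eq]
  split_ifs <;> simp

theorem fourierCoeffCLM_symbolMap_mul_finiteSymbol (g : Mask) (S : Finset ℤ) (f : ℤ → ℝ) (n : ℤ) :
    fourierCoeffCLM n (symbolMap g * finiteSymbol S f)
      = (toeplitz g (∑ i ∈ S, lp.single 2 i (f i) : Seq 2) n : ℝ) := by
  rw [toeplitz_apply, tsum_eq_sum (s := S) fun i hi => by
    rw [sum_single_apply, if_neg hi, mul_zero]]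
  rw [finiteSymbol, Finset.mul_sum, map_sum, Complex.ofReal_sum]
  refine Finset.sum_congr rfl fun i hi => ?_
  rw [sum_single_apply, if_pos hi, mul_smul_comm, map_smul, fourierCoeffCLM_mul_fourier,
    fourierCoeffCLM_symbolMap, smul_eq_mul, Complex.ofReal_mul, mul_comm]

/-- By Parseval the operator is multiplication by the symbol. This is checked on finitely supported
sequences and passes to the limit, the inequality being a closed condition. -/
theorem norm_toeplitz_le {M : ℝ} (hM : 0 ≤ M) {g : Mask}
    (hg : ∀ z : ℂ, ‖z‖ = 1 → ‖symbol g z‖ ≤ M) :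
    ‖(toeplitz g : Seq 2 →L[ℝ] Seq 2)‖ ≤ M := by
  have hfin : ∀ (S : Finset ℤ) (f : ℤ → ℝ), (∑ i ∈ S, lp.single 2 i (f i) : Seq 2) ∈
      {c : Seq 2 | ‖toeplitz g c‖ ≤ M * ‖c‖} := fun S f => by
    have h1 := hasSum_sq_fourierCoeffCLM (finiteSymbol S f)
    have h2 := hasSum_sq_fourierCoeffCLM (symbolMap g * finiteSymbol S f)
    simp_rw [fourierCoeffCLM_finiteSymbol, Complex.norm_real] at h1
    simp_rw [fourierCoeffCLM_symbolMap_mul_finiteSymbol, Complex.norm_real] at h2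
    have e1 := h1.unique (hasSum_sq_norm _)
    have e2 := h2.unique (hasSum_sq_norm _)
    refine (pow_le_pow_iff_left₀ (norm_nonneg _) (mul_nonneg hM (norm_nonneg _)) two_ne_zero).1 ?_
    rw [mul_pow, ← e1, ← e2, ← integral_const_mul]
    have hint : ∀ F : C(UnitAddCircle, ℂ),
        Integrable (fun t => ‖F t‖ ^ 2) (haarAddCircle (T := 1)) := fun F =>
      Continuous.integrable_of_hasCompactSupport (by fun_prop)
        (HasCompactSupport.of_compactSpace _)
    refine integral_mono (hint _) ((hint _).const_mul _) fun t => ?_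
    simp only [ContinuousMap.mul_apply, norm_mul, mul_pow]
    refine mul_le_mul_of_nonneg_right (pow_le_pow_left₀ (norm_nonneg _) ?_ 2) (by positivity)
    rw [symbolMap_apply]
    exact hg _ (norm_fourier_apply 1 t)
  refine ContinuousLinearMap.opNorm_le_bound _ hM fun c => ?_
  have hclosed : IsClosed {c : Seq 2 | ‖toeplitz g c‖ ≤ M * ‖c‖} :=
    isClosed_le (by fun_prop) (by fun_prop)
  exact hclosed.mem_of_tendsto (lp.hasSum_single (by simp) c)
    (Filter.Eventually.of_forall fun S => hfin S c)

/-- The fraction of indices in `[0, N)` that stay in `[0, N)` after a shift by `l`. -/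
noncomputable def shiftFraction (N : ℕ) (l : ℤ) : ℝ :=
  (∑ n ∈ Finset.Ico (0 : ℤ) N, if n - l ∈ Finset.Ico (0 : ℤ) N then (1 : ℝ) else 0) / N

theorem shiftFraction_le_one (N : ℕ) (l : ℤ) : shiftFraction N l ≤ 1 := by
  refine div_le_one_of_le₀ ?_ (by positivity)
  calc _ ≤ ∑ n ∈ Finset.Ico (0 : ℤ) N, (1 : ℝ) :=
        Finset.sum_le_sum fun n _ => by split_ifs <;> norm_num
    _ = N := by simp

theorem shiftFraction_nonneg (N : ℕ) (l : ℤ) : 0 ≤ shiftFraction N l :=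
  div_nonneg (Finset.sum_nonneg fun n _ => by split_ifs <;> norm_num) (by positivity)

theorem le_shiftFraction {N : ℕ} (hN : 0 < N) (l : ℤ) :
    1 - (l.natAbs : ℝ) / N ≤ shiftFraction N l := by
  have hN' : (0 : ℝ) < N := by exact_mod_cast hN
  rw [shiftFraction, le_div_iff₀ hN', sub_mul, div_mul_cancel₀ _ hN'.ne', one_mul,
    ← Finset.sum_filter, Finset.sum_const, nsmul_eq_mul, mul_one]
  have hsub : Finset.Ico (max 0 l) (min (N : ℤ) (N + l)) ⊆
      (Finset.Ico (0 : ℤ) N).filter fun n => n - l ∈ Finset.Ico (0 : ℤ) N := by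
    intro n hn
    simp only [Finset.mem_filter, Finset.mem_Ico] at hn ⊢
    omega
  have hcard := Finset.card_le_card hsub
  rw [Int.card_Ico] at hcard
  rw [sub_le_iff_le_add]
  exact_mod_cast (by omega : N ≤ _ + l.natAbs)

theorem tendsto_shiftFraction (l : ℤ) :
    Filter.Tendsto (fun N : ℕ => shiftFraction N l) Filter.atTop (nhds 1) := by
  have h : Filter.Tendsto (fun N : ℕ => 1 - (l.natAbs : ℝ) / N) Filter.atTop (nhds 1) := by
    simpa using (tendsto_const_div_atTop_nhds_zero_nat (l.natAbs : ℝ)).const_sub 1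
  refine tendsto_of_tendsto_of_tendsto_of_le_of_le' h tendsto_const_nhds ?_
    (Filter.Eventually.of_forall fun N => shiftFraction_le_one N l)
  filter_upwards [Filter.eventually_gt_atTop 0] with N hN using le_shiftFraction hN l

/-- The value of the symbol at `-1` is bounded by the norm of the Toeplitz operator on `l_2`. -/
theorem alternatingSum_le_norm_toeplitz (g : Mask) :
    ∑' l : ℤ, g l * (l.negOnePow : ℤ) ≤ ‖(toeplitz g : Seq 2 →L[ℝ] Seq 2)‖ := by
  set A : Seq 2 →L[ℝ] Seq 2 := toeplitz g with hA
  have hsq : ∀ n : ℤ, ((n.negOnePow : ℤ) : ℝ) * (n.negOnePow : ℤ) = 1 := fun n => by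
    rcases Int.units_eq_one_or n.negOnePow with h | h <;> simp [h]
  -- The sums are Rayleigh quotients of alternating sequences cut to [0, N); dominated convergence
  -- with majorant |g_l| gives their limit.
  have hlim : Filter.Tendsto
      (fun N : ℕ => ∑' l : ℤ, g l * (l.negOnePow : ℤ) * shiftFraction N l) Filter.atTop
      (nhds (∑' l : ℤ, g l * (l.negOnePow : ℤ))) := by
    refine tendsto_tsum_of_dominated_convergence (hasSum_norm_mask g).summable (fun l => ?_)
      (Filter.Eventually.of_forall fun N l => ?_)
    · simpa using (tendsto_shiftFraction l).const_mul (g l * ((l.negOnePow : ℤ) : ℝ))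
    · have h1 : ‖((l.negOnePow : ℤ) : ℝ)‖ = 1 := by
        rcases Int.units_eq_one_or l.negOnePow with h | h <;> simp [h]
      rw [norm_mul, norm_mul, h1, mul_one, Real.norm_of_nonneg (shiftFraction_nonneg N l)]
      exact mul_le_of_le_one_right (norm_nonneg _) (shiftFraction_le_one N l)
  refine le_of_tendsto hlim ?_
  filter_upwards [Filter.eventually_gt_atTop 0] with N hN
  have hN' : (0 : ℝ) < N := by exact_mod_cast hN
  set S := Finset.Ico (0 : ℤ) N with hS
  -- An approximate eigenvector for the frequency z = -1, with squared norm N.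
  set c : Seq 2 := ∑ i ∈ S, lp.single 2 i ((i.negOnePow : ℤ) : ℝ) with hc
  have hcn : ∀ n, c n = if n ∈ S then ((n.negOnePow : ℤ) : ℝ) else 0 := fun n => by
    rw [hc]; exact sum_single_apply S (fun i => ((i.negOnePow : ℤ) : ℝ)) n
  have hnorm : ‖c‖ ^ 2 = N := by
    refine (hasSum_sq_norm c).unique ?_
    have : ∀ n, ‖c n‖ ^ 2 = if n ∈ S then (1 : ℝ) else 0 := fun n => by
      rw [hcn, Real.norm_eq_abs, sq_abs]
      split_ifs
      · rw [sq, hsq]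
      · simp
    simp_rw [this]
    have h : HasSum (fun n : ℤ => if n ∈ S then (1 : ℝ) else 0) _ :=
      hasSum_sum_of_ne_finset_zero (s := S) fun n hn => if_neg hn
    rw [Finset.sum_congr rfl fun n hn => if_pos hn] at h
    simpa [hS] using h
  have hinner : inner ℝ c (A c) ≤ ‖A‖ * N := by
    calc inner ℝ c (A c) ≤ ‖c‖ * ‖A c‖ := real_inner_le_norm _ _
      _ ≤ ‖c‖ * (‖A‖ * ‖c‖) := mul_le_mul_of_nonneg_left (A.le_opNorm c) (norm_nonneg _)
      _ = ‖A‖ * ‖c‖ ^ 2 := by ring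
      _ = _ := by rw [hnorm]
  have hval : inner ℝ c (A c) = N * ∑' l : ℤ, g l * (l.negOnePow : ℤ) * shiftFraction N l := by
    have hsumm : ∀ n, Summable fun l => g l * c (n - l) := fun n => by
      obtain ⟨f, hf, -⟩ := exists_conv g c
      exact (hf n).summable
    have e1 : inner ℝ c (A c) = ∑ n ∈ S, c n * ∑' l, g l * c (n - l) := by
      rw [lp.inner_eq_tsum, tsum_eq_sum (s := S) fun n hn => by rw [hcn, if_neg hn, inner_zero_left]]
      refine Finset.sum_congr rfl fun n _ => ?_
      rw [real_inner_eq_re_inner]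
      simp [hA, toeplitz, conv_apply, mul_comm]
    rw [e1]
    simp_rw [← tsum_mul_left]
    rw [← Summable.tsum_finsetSum fun n _ => (hsumm n).mul_left _]
    refine tsum_congr fun l => ?_
    rw [shiftFraction, ← hS, ← mul_assoc, mul_comm (N : ℝ), mul_assoc, mul_div_cancel₀ _ hN'.ne',
      Finset.mul_sum]
    refine Finset.sum_congr rfl fun n hn => ?_
    rw [hcn n, if_pos hn, hcn (n - l)]
    split_ifs
    · rw [Int.negOnePow_sub, Units.val_mul, Int.cast_mul]
      linear_combination (g l * ((l.negOnePow : ℤ) : ℝ)) * hsq n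
    · simp
  rw [hval, mul_comm] at hinner
  exact le_of_mul_le_mul_right hinner hN'

theorem symbol_neg_one (g : Mask) :
    symbol g (-1) = ((∑' l : ℤ, g l * (l.negOnePow : ℤ) : ℝ) : ℂ) := by
  rw [symbol, Complex.ofReal_tsum]
  refine tsum_congr fun l => ?_
  rw [← Int.cast_negOnePow]
  push_cast
  rfl

/-- The symbol of g is real with values in [1, κ] and reaches κ at -1, so the upper and lower bounds
meet. -/
theorem norm_toeplitz_inverse_eq {κ : ℝ} (hκ : 1 < κ) {a g : Mask}
    (hr : ∀ z : ℂ, ‖z‖ = 1 → ∃ r ∈ Set.Icc (1 / κ) 1, symbol a z = ((r : ℝ) : ℂ))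
    (hmin : symbol a (-1) = ((1 / κ : ℝ) : ℂ)) (hg : IsInverseMask g a) :
    ‖(toeplitz g : Seq 2 →L[ℝ] Seq 2)‖ = κ := by
  have hκ0 : 0 < κ := by linarith
  apply le_antisymm
  · refine norm_toeplitz_le hκ0.le fun z hz => ?_
    obtain ⟨r, hr, hrz⟩ := hr z hz
    have hr0 : 0 < r := lt_of_lt_of_le (by positivity) hr.1
    have h := hg z hz
    rw [hrz] at h
    rw [eq_div_of_mul_eq (right_ne_zero_of_mul_eq_one h) h, norm_div, norm_one, Complex.norm_real,
      Real.norm_of_nonneg hr0.le]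
    exact (one_div_le hr0 hκ0).2 hr.1
  · refine le_trans (le_of_eq ?_) (alternatingSum_le_norm_toeplitz g)
    have h := hg (-1) (by simp)
    rw [hmin, symbol_neg_one, ← Complex.ofReal_mul] at h
    have h' : (∑' l : ℤ, g l * (l.negOnePow : ℤ) : ℝ) * (1 / κ) = 1 := by exact_mod_cast h
    field_simp at h'
    exact h'.symm

end OperatorNorm

/-! ### Pseudo-spline masks and pyramid stability -/

section PseudoSpline

theorem hasSum_coeff_mul_zpow (f : ℝ[T;T⁻¹]) (u : ℂˣ) :
    HasSum (fun m : ℤ => (f.coeff m : ℂ) * (u : ℂ) ^ m)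
      (LaurentPolynomial.eval₂ Complex.ofRealHom u f) := by
  induction f using LaurentPolynomial.induction_on' with
  | add p q hp hq =>
    rw [map_add]
    convert! hp.add hq using 2 with m
    rw [AddMonoidAlgebra.coeff_add, Finsupp.add_apply, Complex.ofReal_add, add_mul]
  | C_mul_T n r =>
    rw [map_mul, LaurentPolynomial.eval₂_C, LaurentPolynomial.eval₂_T, Units.val_zpow_eq_zpow_val]
    have hc : ∀ m : ℤ, (LaurentPolynomial.C r * LaurentPolynomial.T n : ℝ[T;T⁻¹]).coeff m
        = if m = n then r else 0 := fun m => by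
      rw [← LaurentPolynomial.single_eq_C_mul_T]
      rw [AddMonoidAlgebra.coeff_single, Finsupp.single_apply]
      exact if_congr eq_comm rfl rfl
    simp_rw [hc]
    convert! hasSum_ite_eq n ((r : ℂ) * (u : ℂ) ^ n) using 2 with m
    by_cases hm : m = n
    · rw [if_pos hm, if_pos hm, hm]
    · rw [if_neg hm, if_neg hm, Complex.ofReal_zero, zero_mul]

/-- The key identity is u⁻¹(1 + u)² = 4(1 - y), with y the argument of B; the factor 2 is 4^k /
2^(2k-1). -/
theorem symbol_pseudoSplineMask {k : ℕ} (hk : 1 ≤ k) (ν : ℕ) {u : ℂ} (hu : u ≠ 0) :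
    symbol (pseudoSplineMask k ν) u
      = 2 * Polynomial.aeval (1 / 2 - (u + u⁻¹) / 4) (basicPoly k ν) := by
  have h := (hasSum_coeff_mul_zpow (pseudoSplineSymbol k ν) (Units.mk0 u hu)).tsum_eq
  have h' : symbol (pseudoSplineMask k ν) u
      = LaurentPolynomial.eval₂ Complex.ofRealHom (Units.mk0 u hu) (pseudoSplineSymbol k ν) := h
  rw [h', pseudoSplineSymbol, basicPoly]
  simp only [map_mul, map_pow, map_add, map_one, map_sum, map_sub, LaurentPolynomial.eval₂_C,
    LaurentPolynomial.eval₂_T, Polynomial.aeval_C, Polynomial.aeval_X,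
    Units.val_mk0, zpow_one, zpow_neg, zpow_natCast, Units.val_inv_eq_inv_val, Units.val_pow_eq_pow_val]
  have e1 : (u ^ k)⁻¹ * (1 + u) ^ (2 * k) = 4 ^ k * (1 - (1 / 2 - (u + u⁻¹) / 4)) ^ k := by
    rw [pow_mul, ← inv_pow, ← mul_pow, ← mul_pow]
    congr 1
    field_simp
    ring
  have e2 : (2 : ℂ) ^ (2 * k - 1) * 2 = 4 ^ k := by
    rw [← pow_succ, show 2 * k - 1 + 1 = 2 * k by omega, pow_mul]
    norm_num
  have e3 : ∀ w : ℂ, Complex.ofRealHom (1 / 2 ^ (2 * k - 1)) * (4 ^ k * w) = 2 * w := fun w => by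
    rw [← e2]
    simp
    field_simp
  rw [mul_assoc (Complex.ofRealHom _), e1, mul_assoc (Complex.ofRealHom _), mul_assoc (4 ^ k), e3]
  congr 2
  refine Finset.sum_congr rfl fun j _ => ?_
  simp
  left
  ring

theorem symbolMap_pseudoSplineMask_mem {k : ℕ} (hk : 1 ≤ k) (ν : ℕ) :
    symbolMap (pseudoSplineMask k ν) ∈ trigPoly (k + ν) := by
  set y : C(UnitAddCircle, ℂ) := (1 / 2 : ℂ) • 1 - (1 / 4 : ℂ) • (fourier 1 + fourier (-1)) with hy
  have hmem : y ∈ trigPoly 1 :=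
    Submodule.sub_mem _ (Submodule.smul_mem _ _ (one_mem_trigPoly 1)) (Submodule.smul_mem _ _
      (Submodule.add_mem _ (fourier_mem_trigPoly (by simp)) (fourier_mem_trigPoly (by simp))))
  have h : symbolMap (pseudoSplineMask k ν) = (2 : ℂ) • Polynomial.aeval y (basicPoly k ν) := by
    ext x
    have hne : (fourier 1 x : ℂ) ≠ 0 := by
      rw [← norm_ne_zero_iff, norm_fourier_apply]; exact one_ne_zero
    have hyx : y x = 1 / 2 - (fourier 1 x + (fourier 1 x : ℂ)⁻¹) / 4 := by
      change (1 / 2 : ℂ) * 1 - 1 / 4 * (fourier 1 x + fourier (-1) x) = _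
      rw [fourier_eq_zpow (-1), zpow_neg_one]
      ring
    rw [symbolMap_apply, symbol_pseudoSplineMask hk ν hne, ← hyx, ← aeval_continuousMap_apply]
    rfl
  rw [h]
  have := aeval_mem_trigPoly hmem (natDegree_basicPoly_le k ν)
  rw [mul_one] at this
  exact Submodule.smul_mem _ _ this

/-- The full mask has band k + ν; entry m of the even part is entry 2m, which halves the band,
rounded down. -/
theorem downsample_pseudoSplineMask_eq_zero {k : ℕ} (hk : 1 ≤ k) (ν : ℕ) {m : ℤ}
    (hm : (((k + ν) / 2 : ℕ) : ℤ) < |m|) : downsample (pseudoSplineMask k ν) m = 0 := by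
  have h := fourierCoeffCLM_eq_zero (symbolMap_pseudoSplineMask_mem hk ν) (m := 2 * m)
    (by rw [abs_mul, abs_two]; omega)
  rw [fourierCoeffCLM_symbolMap] at h
  rw [downsample_apply]
  exact_mod_cast h

theorem hasSum_symbol (a : Mask) {z : ℂ} (hz : ‖z‖ = 1) :
    HasSum (fun m : ℤ => (a m : ℂ) * z ^ m) (symbol a z) := by
  obtain ⟨x, rfl⟩ := exists_fourier_one_eq hz
  rw [← symbolMap_apply]
  convert! hasSum_symbolMap a x using 3 with m
  rw [fourier_eq_zpow m x]

/-- Averaging over ±u removes the odd powers. -/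
theorem symbol_downsample (a : Mask) {u : ℂ} (hu : ‖u‖ = 1) :
    symbol (downsample a) (u ^ 2) = (symbol a u + symbol a (-u)) / 2 := by
  have hinj : Function.Injective fun k : ℤ => 2 * k := fun a b h => by simpa using h
  have h := ((hasSum_symbol a hu).add (hasSum_symbol a (z := -u) (by rwa [norm_neg]))).div_const 2
  have h2 := (hinj.hasSum_iff (f := fun m : ℤ => ((a m : ℂ) * u ^ m + a m * (-u) ^ m) / 2)
    (fun m hm => by
      have hodd : Odd m := by
        rw [← Int.not_even_iff_odd]
        exact fun ⟨n, hn⟩ => hm ⟨n, by simp only; omega⟩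
      rw [hodd.neg_zpow]
      ring)).2 h
  rw [← h2.tsum_eq, symbol]
  refine tsum_congr fun m => ?_
  simp only [Function.comp_apply, downsample_apply]
  rw [(even_two_mul m).neg_zpow, zpow_mul]
  norm_cast
  ring

theorem symbol_downsample_pseudoSplineMask {k : ℕ} (hk : 1 ≤ k) (ν : ℕ) {u : ℂ} (hu : ‖u‖ = 1) :
    symbol (downsample (pseudoSplineMask k ν)) (u ^ 2)
      = ((evenPart k ν (1 / 2 - u.re / 2) : ℝ) : ℂ) := by
  have hu0 : u ≠ 0 := by rw [← norm_ne_zero_iff, hu]; exact one_ne_zero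
  have hre : u + u⁻¹ = ((2 * u.re : ℝ) : ℂ) := by
    rw [Complex.inv_eq_conj hu, Complex.add_conj]
  have e1 : (1 / 2 - (u + u⁻¹) / 4 : ℂ) = algebraMap ℝ ℂ (1 / 2 - u.re / 2) := by
    rw [hre, Complex.coe_algebraMap]; push_cast; ring
  have e2 : (1 / 2 - (-u + (-u)⁻¹) / 4 : ℂ) = algebraMap ℝ ℂ (1 - (1 / 2 - u.re / 2)) := by
    rw [inv_neg, ← neg_add, hre, Complex.coe_algebraMap]; push_cast; ring
  rw [symbol_downsample _ hu, symbol_pseudoSplineMask hk ν hu0,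
    symbol_pseudoSplineMask hk ν (neg_ne_zero.2 hu0), e1, e2,
    Polynomial.aeval_algebraMap_apply_eq_algebraMap_eval,
    Polynomial.aeval_algebraMap_apply_eq_algebraMap_eval, evenPart, Complex.coe_algebraMap,
    Complex.ofReal_add]
  ring

theorem exists_symbol_downsample_pseudoSplineMask_eq {k ν : ℕ} (hk : 2 ≤ k) (hν : ν ≤ k - 2)
    (z : ℂ) (hz : ‖z‖ = 1) : ∃ r ∈ Set.Icc (1 / kappa k ν) 1,
      symbol (downsample (pseudoSplineMask k ν)) z = ((r : ℝ) : ℂ) := by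
  obtain ⟨u, rfl⟩ := IsAlgClosed.exists_pow_nat_eq z (n := 2) two_pos
  have hu : ‖u‖ = 1 := by
    rw [norm_pow] at hz
    exact (pow_eq_one_iff_of_nonneg (norm_nonneg _) two_ne_zero).1 hz
  refine ⟨_, ?_, symbol_downsample_pseudoSplineMask (by omega) ν hu⟩
  rw [← evenPart_half (by omega : 1 ≤ k)]
  have h := Complex.abs_re_le_norm u
  rw [hu, abs_le] at h
  exact evenPart_mem_Icc hk hν ⟨by linarith [h.2], by linarith [h.1]⟩

theorem symbol_downsample_pseudoSplineMask_neg_one {k : ℕ} (hk : 1 ≤ k) (ν : ℕ) :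
    symbol (downsample (pseudoSplineMask k ν)) (-1) = ((1 / kappa k ν : ℝ) : ℂ) := by
  -- The square root u = i of -1 has real part 0, so y = 1/2, the minimum point.
  have h := symbol_downsample_pseudoSplineMask hk ν (u := Complex.I) Complex.norm_I
  rwa [Complex.I_sq, Complex.I_re, zero_div, sub_zero, evenPart_half hk] at h

theorem stabConst_pos {k ν : ℕ} (hk : 2 ≤ k) (hν : ν ≤ k - 2) : 0 < stabConst k ν := by
  have hκ := one_lt_kappa hk hν
  obtain ⟨h0, h1⟩ := decayRate_mem_Ioo hκ (s := (k + ν) / 2) (by omega)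
  have h0' : 0 < lam k ν := h0
  have h1' : lam k ν < 1 := h1
  refine mul_pos (mul_pos (by linarith) (lt_of_lt_of_le one_pos (le_max_left _ _))) ?_
  exact div_pos (by linarith) (by linarith)

/-- By linearity the difference of two pyramids is a pyramid. Level l is reached from level j by j -
l decimations, costing M^(j-l), and its detail is Id - S_a D_g applied to that level. -/
theorem norm_pyramid_sub_le {p : ℝ≥0∞} [Fact (1 ≤ p)] {a g : Mask} {M : ℝ} (hM : 0 < M)
    (hD : ‖(decimation g : Seq p →L[ℝ] Seq p)‖ ≤ M) {j : ℕ} {c d c' d' : ℕ → Seq p}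
    (h : IsPyramid a g j c d) (h' : IsPyramid a g j c' d') :
    ‖c 0 - c' 0‖ ≤ M ^ j * ‖c j - c' j‖ ∧
    ∀ l ∈ Finset.Icc 1 j, ‖d l - d' l‖ ≤
      (‖ContinuousLinearMap.id ℝ (Seq p) - (subdivision a).comp (decimation g)‖
        * M ^ j * ‖c j - c' j‖) * M ^ (-(l : ℤ)) := by
  have hc : ∀ i ≤ j, ‖c (j - i) - c' (j - i)‖ ≤ M ^ i * ‖c j - c' j‖ := by
    intro i hi
    induction i with
    | zero => simp
    | succ i ih =>
      have hmem : j - i ∈ Finset.Icc 1 j := Finset.mem_Icc.2 ⟨by omega, by omega⟩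
      rw [show j - (i + 1) = j - i - 1 by omega, (h _ hmem).1, (h' _ hmem).1, ← map_sub, pow_succ',
        mul_assoc]
      exact ((decimation g).le_of_opNorm_le hD _).trans
        (mul_le_mul_of_nonneg_left (ih (by omega)) hM.le)
  refine ⟨by simpa using hc j le_rfl, fun l hl => ?_⟩
  obtain ⟨h1, h2⟩ := Finset.mem_Icc.1 hl
  set E : Seq p →L[ℝ] Seq p := ContinuousLinearMap.id ℝ (Seq p)
    - (subdivision a).comp (decimation g) with hE
  have hd : d l - d' l = E (c l - c' l) := by
    rw [(h l hl).2, (h' l hl).2, (h l hl).1, (h' l hl).1]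
    simp only [hE, sub_apply, ContinuousLinearMap.id_apply,
      ContinuousLinearMap.comp_apply, map_sub]
  have hcl := hc (j - l) (Nat.sub_le _ _)
  rw [Nat.sub_sub_self h2] at hcl
  have hpow : M ^ (j - l) = M ^ j * M ^ (-(l : ℤ)) := by
    rw [← zpow_natCast, ← zpow_natCast, ← zpow_add₀ hM.ne']
    congr 1
    omega
  rw [hd]
  refine (E.le_opNorm _).trans ((mul_le_mul_of_nonneg_left hcl (norm_nonneg E)).trans (le_of_eq ?_))
  rw [hpow]
  ring

end PseudoSpline

end MTER

theorem mainTheorem11 (k ν : ℕ) (hk : 2 ≤ k) (hν : ν ≤ k - 2) :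
    (∃! γ : MTER.Mask,
      MTER.IsInverseMask γ (MTER.downsample (MTER.pseudoSplineMask k ν))) ∧
    ∀ γ : MTER.Mask,
      MTER.IsInverseMask γ (MTER.downsample (MTER.pseudoSplineMask k ν)) →
      -- the case of the sup norm
      (∀ (j : ℕ) (c d c' d' : ℕ → MTER.Seq ⊤),
        MTER.IsPyramid (MTER.pseudoSplineMask k ν) γ j c d →
        MTER.IsPyramid (MTER.pseudoSplineMask k ν) γ j c' d' →
        ‖c 0 - c' 0‖ ≤ MTER.stabConst k ν ^ j * ‖c j - c' j‖ ∧
        ∀ l ∈ Finset.Icc 1 j,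
          ‖d l - d' l‖ ≤
            (‖ContinuousLinearMap.id ℝ (MTER.Seq ⊤)
                - (MTER.subdivision (MTER.pseudoSplineMask k ν)).comp (MTER.decimation γ)‖
              * MTER.stabConst k ν ^ j * ‖c j - c' j‖) * MTER.stabConst k ν ^ (-(l : ℤ))) ∧
      -- the case of the Euclidean norm
      (‖(MTER.decimation γ : MTER.Seq 2 →L[ℝ] MTER.Seq 2)‖
          = ‖(MTER.toeplitz γ : MTER.Seq 2 →L[ℝ] MTER.Seq 2)‖ ∧
        ‖(MTER.toeplitz γ : MTER.Seq 2 →L[ℝ] MTER.Seq 2)‖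
          = 2 ^ (k + ν - 1) / ∑ i ∈ Finset.range (ν + 1), ((k + ν).choose i : ℝ) ∧
        ∀ (j : ℕ) (c d c' d' : ℕ → MTER.Seq 2),
          MTER.IsPyramid (MTER.pseudoSplineMask k ν) γ j c d →
          MTER.IsPyramid (MTER.pseudoSplineMask k ν) γ j c' d' →
          ‖c 0 - c' 0‖
            ≤ ‖(MTER.decimation γ : MTER.Seq 2 →L[ℝ] MTER.Seq 2)‖ ^ j * ‖c j - c' j‖ ∧
          ∀ l ∈ Finset.Icc 1 j,
            ‖d l - d' l‖ ≤
              (‖ContinuousLinearMap.id ℝ (MTER.Seq 2)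
                  - (MTER.subdivision (MTER.pseudoSplineMask k ν)).comp (MTER.decimation γ)‖
                * ‖(MTER.decimation γ : MTER.Seq 2 →L[ℝ] MTER.Seq 2)‖ ^ j * ‖c j - c' j‖)
                * ‖(MTER.decimation γ : MTER.Seq 2 →L[ℝ] MTER.Seq 2)‖ ^ (-(l : ℤ))) := by
  have hκ := MTER.one_lt_kappa hk hν
  have hs : 1 ≤ (k + ν) / 2 := by omega
  have hsupp := fun m : ℤ => MTER.downsample_pseudoSplineMask_eq_zero (by omega : 1 ≤ k) ν (m := m)
  have hr := MTER.exists_symbol_downsample_pseudoSplineMask_eq hk hν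
  refine ⟨MTER.existsUnique_inverseMask hκ hs hsupp hr, fun γ hγ => ⟨?_, ?_⟩⟩
  · intro j c d c' d' h h'
    refine MTER.norm_pyramid_sub_le (MTER.stabConst_pos hk hν) ?_ h h'
    rw [MTER.norm_decimation_eq]
    -- The sup-norm operator bound is the l_1 norm of γ, which the summed decay bound controls by
    -- C(k,ν).
    exact (MTER.norm_conv_le γ).trans (MTER.norm_inverseMask_le hκ hs hsupp hr hγ)
  · have hA := MTER.norm_toeplitz_inverse_eq hκ hr
      (MTER.symbol_downsample_pseudoSplineMask_neg_one (by omega) ν) hγ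
    have hD := MTER.norm_decimation_eq (p := 2) γ
    -- Here M is the norm of D_γ itself, positive because it equals κ > 1.
    refine ⟨hD, hA, fun j c d c' d' h h' => MTER.norm_pyramid_sub_le ?_ le_rfl h h'⟩
    rw [hD, hA]
    linarith
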